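/- Let $d\ge 1$ and let $\mathbb{R}^{d+1}$ be the space of points $z=(t,x)$, $t\in\mathbb{R}$, $x\in\mathbb{R}^d$, with Lebesgue measure. For $\rho>0$ put $C_\rho(t,x)=\{(s,y): |x-y|<\rho,\ t\le s<t+\rho^2\}$. For $q\ge 1$ let $E_{q,1}$ be the space of measurable (real- or $\mathbb{R}^m$-valued) functions $b$ on $\mathbb{R}^{d+1}$ with $$\|b\|_{E_{q,1}}:=\sup_{0<\rho<\infty,\ z\in\mathbb{R}^{d+1}}\rho\,\Big(\frac{1}{|C_\rho(z)|}\int_{C_\rho(z)}|b|^q\,dw\Big)^{1/q}<\infty .$$ For measurable $f\ge 0$ on $\mathbb{R}^{d+1}$ put $$P_1f(t,x)=\int_0^\infty\!\!\int_{\mathbb{R}^d}\frac{1}{s^{(d+1)/2}}\,e^{-|y|^2/s}\,f(t+s,x+y)\,dy\,ds\in[0,\infty].$$ Theorem. Let $d+2\ge q>p>1$. There is a constant $N<\infty$ depending only on $d,p,q$ such that for every $b\in E_{q,1}$: (i) for every measurable $f\ge 0$, $$\int_{\mathbb{R}^{d+1}}|b|^p(P_1f)^p\,dz\le N\,\|b\|_{E_{q,1}}^p\,\|f\|_{L_p(\mathbb{R}^{d+1})}^p$$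 (with the convention $0\cdot\infty=0$ on the right); (ii) for every $u\in C_0^\infty(\mathbb{R}^{d+1})$, with $Du$ and $D^2u$ the gradient and the Hessian of $u$ in $x$, $$\int_{\mathbb{R}^{d+1}}|b|^p|Du|^p\,dz\le N\,\|b\|_{E_{q,1}}^p\int_{\mathbb{R}^{d+1}}\big(|D^2u|^2+|\partial_tu|^2\big)^{p/2}\,dz ,$$ where $|D^2u|^2=\sum_{i,j}|D_iD_ju|^2$. -/

import Mathlib

open MeasureTheory
open scoped ENNReal NNReal ContDiff

noncomputable section

namespace ParabolicMorrey

/-- The space `ℝ^{d+1}` of points `z = (t, x)`, `t ∈ ℝ`, `x ∈ ℝ^d`; its measure `volume` is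
Lebesgue measure `dx dt`. -/
abbrev Spacetime (d : ℕ) : Type := ℝ × EuclideanSpace ℝ (Fin d)

/-- The parabolic cylinder `C_ρ(t, x) = {(s, y) : |x - y| < ρ, t ≤ s < t + ρ ^ 2}`. -/
def paraCylinder {d : ℕ} (ρ : ℝ) (z : Spacetime d) : Set (Spacetime d) :=
  {w | ‖z.2 - w.2‖ < ρ ∧ z.1 ≤ w.1 ∧ w.1 < z.1 + ρ ^ 2}

/-- The Morrey norm
`sup_{0 < ρ < ∞, z} ρ ^ β * (|C_ρ(z)|⁻¹ ∫_{C_ρ(z)} |g| ^ q) ^ (1 / q)`, with values in `[0, ∞]`. -/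
def morreyNorm {d m : ℕ} (q β : ℝ) (g : Spacetime d → EuclideanSpace ℝ (Fin m)) : ℝ≥0∞ :=
  ⨆ (ρ : ℝ) (_ : 0 < ρ) (z : Spacetime d),
    ENNReal.ofReal (ρ ^ β) * (⨍⁻ w in paraCylinder ρ z, ‖g w‖ₑ ^ q ∂volume) ^ (1 / q)

/-- Membership in the parabolic Morrey space `E_{q,β}` on the whole space. -/
def MemMorrey {d m : ℕ} (q β : ℝ) (g : Spacetime d → EuclideanSpace ℝ (Fin m)) : Prop :=
  AEStronglyMeasurable g volume ∧ morreyNorm q β g < (⊤ : ℝ≥0∞)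

/-- The kernel `p_α(s, r) = s ^ (-(d + 2 - α) / 2) * exp (-r ^ 2 / s)` for `s > 0`, and `0` for
`s ≤ 0`. -/
def kernel (d : ℕ) (α s r : ℝ) : ℝ :=
  if 0 < s then (1 / s ^ (((d : ℝ) + 2 - α) / 2)) * Real.exp (-r ^ 2 / s) else 0

/-- The parabolic potential
`P_α f (t, x) = ∫ p_α(s, |y|) f (t + s, x + y) dy ds` of a function with values in `[0, ∞]`. -/
def potential {d : ℕ} (α : ℝ) (f : Spacetime d → ℝ≥0∞) (z : Spacetime d) : ℝ≥0∞ :=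
  ∫⁻ w : Spacetime d, ENNReal.ofReal (kernel d α w.1 ‖w.2‖) * f (z + w)

/-- The time derivative `∂_t u`. -/
def timeDeriv {d : ℕ} (u : Spacetime d → ℝ) (z : Spacetime d) : ℝ :=
  lineDeriv ℝ u z (1, 0)

/-- The spatial partial derivative `D_i u`. -/
def spaceDeriv {d : ℕ} (i : Fin d) (u : Spacetime d → ℝ) (z : Spacetime d) : ℝ :=
  lineDeriv ℝ u z (0, EuclideanSpace.single i 1)

/-- The spatial gradient `Du = (D_1 u, …, D_d u)`. -/
def spaceGrad {d : ℕ} (u : Spacetime d → ℝ) (z : Spacetime d) : EuclideanSpace ℝ (Fin d) :=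
  WithLp.toLp 2 fun i => spaceDeriv i u z

/-- The Euclidean length `|(D²u, ∂_t u)|` of the array of all `D_i D_j u` and `∂_t u`. -/
def hessTimeNorm {d : ℕ} (u : Spacetime d → ℝ) (z : Spacetime d) : ℝ :=
  Real.sqrt ((∑ i : Fin d, ∑ j : Fin d, spaceDeriv i (spaceDeriv j u) z ^ 2) + timeDeriv u z ^ 2)

end ParabolicMorrey

end

/-! Both inequalities reduce to one Adams-type estimate for the dyadic Riesz potential `rieszSum f
z`, the sum over `k` of `2 ^ (-k (d + 1))` times the integral of `f` over the parabolic box of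
radius `2 ^ k` about `z`.

Pointwise reductions. The kernel of the potential is at most a constant times `max (|y|, √s) ^ (-(d
+ 1))`, hence `potential 1 f ≤ c * rieszSum f` (`potential_one_le_rieszSum`). For the gradient, `D_i
u` is averaged against a bump at parabolic scale `ε`. The averages tend to a multiple of `D_i u z`
as `ε → 0` and to `0` as `ε → ∞`, while their derivative in `ε` is at most a constant times `ε ^
(-(d + 2))` times the integral of `|(D²u, ∂_t u)|` over the box of radius `ε`. Summing over dyadic
intervals gives `|Du| ≤ C * rieszSum |(D²u, ∂_t u)|` (`exists_enorm_spaceGrad_le`).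

Adams estimate (`exists_lintegral_rieszSum_rpow_le`). By duality it suffices to bound the integral
of `g |b| rieszSum f` for `g` in `L_{p'}`. A Vitali selection at each height `2 ^ j` of the averages
of `f` bounds it by the integral of `M f * M₁ (|b| g)`, where `M = fracMax (d + 2)` and `M₁ =
fracMax (d + 1)` (`exists_lintegral_mul_rieszSum_le`). Hölder's inequality on each box and the
Morrey condition give `M₁ (|b| g) ≤ C ‖b‖ (M (g ^ q')) ^ (1 / q')` (`exists_fracMax_mul_le`). Hölder
with `p, p'` and the maximal theorem in `L_p` and in `L_{p'/q'}` conclude; `p < q` is what makes `p'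
/ q' > 1`. -/

noncomputable section

namespace ParabolicMorrey

/-! ### Dyadic sums in `[0, ∞]` -/

/-- The value `∑_{i ≥ 0} 2 ^ (-s i)` of the geometric series. -/
def geomConst (s : ℝ) : ℝ≥0∞ := (1 - (2 : ℝ≥0∞) ^ (-s))⁻¹

lemma geomConst_ne_top {s : ℝ} (hs : 0 < s) : geomConst s ≠ ⊤ := by
  have h : (2 : ℝ≥0∞) ^ (-s) < 1 :=
    ENNReal.rpow_lt_one_of_one_lt_of_neg (by norm_num) (by linarith)
  exact ENNReal.inv_ne_top.2 (tsub_pos_of_lt h).ne'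

lemma two_zpow_ne_zero (j : ℤ) : (2 : ℝ≥0∞) ^ j ≠ 0 :=
  (ENNReal.zpow_pos (by norm_num) (by norm_num) j).ne'

lemma two_zpow_ne_top (j : ℤ) : (2 : ℝ≥0∞) ^ j ≠ ⊤ :=
  ENNReal.zpow_ne_top (by norm_num) (by norm_num) j

lemma ofReal_two_zpow (k : ℤ) : ENNReal.ofReal ((2 : ℝ) ^ k) = (2 : ℝ≥0∞) ^ k := by
  have h : (2 : ℝ) ^ k = (((2 : ℝ≥0) ^ k : ℝ≥0) : ℝ) := by push_cast; rfl
  rw [h, ENNReal.ofReal_coe_nnreal, ENNReal.coe_zpow (by norm_num)]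
  simp

lemma tsum_zpow_le (n : ℤ) (s : ℝ) :
    ∑' j : ℤ, (if j ≤ n then ((2 : ℝ≥0∞) ^ j) ^ s else 0) = geomConst s * ((2 : ℝ≥0∞) ^ n) ^ s := by
  have hinj : Function.Injective (fun i : ℕ => n - (i : ℤ)) := by
    intro a b h
    simp only at h
    omega
  have hsupp : Function.support (fun j : ℤ => if j ≤ n then ((2 : ℝ≥0∞) ^ j) ^ s else 0) ⊆
      Set.range (fun i : ℕ => n - (i : ℤ)) := by
    intro j hj
    have hjn : j ≤ n := by
      by_contra h
      exact hj (by simp [h])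
    exact ⟨(n - j).toNat, by simp only; omega⟩
  rw [← hinj.tsum_eq hsupp, geomConst, ← ENNReal.tsum_geometric, ← ENNReal.tsum_mul_right]
  refine tsum_congr fun i => ?_
  rw [if_pos (by omega)]
  simp only [← ENNReal.rpow_intCast, ← ENNReal.rpow_natCast, ← ENNReal.rpow_mul]
  rw [← ENNReal.rpow_add _ _ (by norm_num) (by norm_num)]
  congr 1
  push_cast
  ring

/-- The dyadic layer sum `∑_{2 ^ j < x} 2 ^ (s j)`. -/
def layerSum (s : ℝ) (x : ℝ≥0∞) : ℝ≥0∞ :=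
  ∑' j : ℤ, if (2 : ℝ≥0∞) ^ j < x then ((2 : ℝ≥0∞) ^ j) ^ s else 0

/-- When `2 ^ n < x ≤ 2 ^ (n + 1)`, only the layers `j ≤ n` occur, and their geometric series is a
multiple of its top term `2 ^ (s n) ≤ x ^ s`. -/
lemma layerSum_le {s : ℝ} (hs : 0 < s) (x : ℝ≥0∞) : layerSum s x ≤ geomConst s * x ^ s := by
  rcases eq_or_ne x 0 with rfl | h0
  · simp [layerSum]
  rcases eq_or_ne x ⊤ with rfl | ht
  · have : geomConst s ≠ 0 := by
      simp [geomConst]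
    simp [ENNReal.top_rpow_of_pos hs, ENNReal.mul_top this]
  obtain ⟨n, hn1, hn2⟩ := ENNReal.exists_mem_Ioc_zpow h0 ht (y := 2) (by norm_num) (by norm_num)
  calc layerSum s x ≤ ∑' j : ℤ, (if j ≤ n then ((2 : ℝ≥0∞) ^ j) ^ s else 0) := by
        refine ENNReal.tsum_le_tsum fun j => ?_
        split_ifs with h1 h2
        · exact le_rfl
        · exfalso
          refine absurd (h1.trans_le hn2) (not_lt.2 ?_)
          exact ENNReal.zpow_le_of_le (by norm_num) (by omega)
        · exact zero_le
        · exact le_rfl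
    _ = geomConst s * ((2 : ℝ≥0∞) ^ n) ^ s := tsum_zpow_le n s
    _ ≤ geomConst s * x ^ s := by gcongr

/-- The top layer alone suffices, since `x ≤ 2 * 2 ^ n`. For `x = ⊤` every layer is present and the
sum exceeds any bound. -/
lemma rpow_le_layerSum {s : ℝ} (hs : 0 < s) (x : ℝ≥0∞) : x ^ s ≤ 2 ^ s * layerSum s x := by
  have key : ∀ n : ℤ, (2 : ℝ≥0∞) ^ n < x → ((2 : ℝ≥0∞) ^ (n + 1)) ^ s ≤ 2 ^ s * layerSum s x := by
    intro n hn
    have h2 : (2 : ℝ≥0∞) ^ (n + 1) = 2 * 2 ^ n := by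
      rw [ENNReal.zpow_add (by norm_num) (by norm_num), zpow_one, mul_comm]
    rw [h2, ENNReal.mul_rpow_of_nonneg _ _ hs.le]
    gcongr
    refine le_trans ?_ (ENNReal.le_tsum n)
    rw [if_pos hn]
  rcases eq_or_ne x 0 with rfl | h0
  · simp [ENNReal.zero_rpow_of_pos hs]
  rcases eq_or_ne x ⊤ with rfl | ht
  · rw [ENNReal.top_rpow_of_pos hs, top_le_iff]
    by_contra hne
    obtain ⟨m, hm⟩ := ENNReal.exists_nat_gt (r := (2 ^ s * layerSum s ⊤) ^ (1 / s))
      (ENNReal.rpow_ne_top_of_nonneg (by positivity) hne)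
    have h1 := key m (two_zpow_ne_top m).lt_top
    have h2 : (2 : ℝ≥0∞) ^ ((m : ℤ) + 1) ≤ (2 ^ s * layerSum s ⊤) ^ (1 / s) := by
      rw [one_div]
      exact (ENNReal.le_rpow_inv_iff hs).2 h1
    have h3 : (m : ℝ≥0∞) ≤ (2 : ℝ≥0∞) ^ ((m : ℤ) + 1) := by
      have : m ≤ 2 ^ (m + 1) :=
        (Nat.lt_two_pow_self.le).trans (Nat.pow_le_pow_right (by norm_num) (by omega))
      have h4 : (2 : ℝ≥0∞) ^ ((m : ℤ) + 1) = ((2 ^ (m + 1) : ℕ) : ℝ≥0∞) := by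
        push_cast
        rw [← zpow_natCast]
        push_cast
        rfl
      rw [h4]
      exact_mod_cast this
    exact absurd (h3.trans h2) (not_le.2 hm)
  obtain ⟨n, hn1, hn2⟩ := ENNReal.exists_mem_Ioc_zpow h0 ht (y := 2) (by norm_num) (by norm_num)
  exact le_trans (by gcongr) (key n hn1)

/-! ### Parabolic boxes -/

variable {d : ℕ}

/-- The symmetric parabolic box of radius `ρ` about `z`. -/
def box (z : Spacetime d) (ρ : ℝ) : Set (Spacetime d) :=
  Metric.ball z.1 (ρ ^ 2) ×ˢ Metric.ball z.2 ρ

lemma mem_box {z w : Spacetime d} {ρ : ℝ} :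
    w ∈ box z ρ ↔ |w.1 - z.1| < ρ ^ 2 ∧ ‖w.2 - z.2‖ < ρ := by
  simp [box, Set.mem_prod, dist_eq_norm]

lemma isOpen_box (z : Spacetime d) (ρ : ℝ) : IsOpen (box z ρ) :=
  Metric.isOpen_ball.prod Metric.isOpen_ball

lemma measurableSet_box (z : Spacetime d) (ρ : ℝ) : MeasurableSet (box z ρ) :=
  (isOpen_box z ρ).measurableSet

lemma self_mem_box (z : Spacetime d) {ρ : ℝ} (hρ : 0 < ρ) : z ∈ box z ρ := by
  rw [mem_box]
  simp [hρ]

lemma box_mono (z : Spacetime d) {ρ r : ℝ} (hρ : 0 ≤ ρ) (h : ρ ≤ r) : box z ρ ⊆ box z r := by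
  intro w hw
  rw [mem_box] at hw ⊢
  exact ⟨hw.1.trans_le (by gcongr), hw.2.trans_le h⟩

/-- In space the triangle inequality gives `2 ρ + r ≤ 5 r`; in time it gives `2 ρ ^ 2 + r ^ 2 ≤ 9 r
^ 2`, which is within `(5 r) ^ 2`. -/
lemma box_subset_of_inter {z w : Spacetime d} {ρ r : ℝ} (hρ : 0 < ρ) (h : ρ ≤ 2 * r)
    (hne : (box z ρ ∩ box w r).Nonempty) : box z ρ ⊆ box w (5 * r) := by
  obtain ⟨v, hv1, hv2⟩ := hne
  intro x hx
  rw [mem_box] at *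
  constructor
  · have h1 : x.1 - w.1 = (x.1 - z.1) - (v.1 - z.1) + (v.1 - w.1) := by ring
    have h2 : |x.1 - w.1| ≤ |x.1 - z.1| + |v.1 - z.1| + |v.1 - w.1| := by
      rw [h1]
      exact (abs_add_le _ _).trans (by gcongr; exact abs_sub _ _)
    nlinarith [hx.1, hv1.1, hv2.1]
  · have h1 : x.2 - w.2 = (x.2 - z.2) - (v.2 - z.2) + (v.2 - w.2) := by abel
    have h2 : ‖x.2 - w.2‖ ≤ ‖x.2 - z.2‖ + ‖v.2 - z.2‖ + ‖v.2 - w.2‖ := by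
      rw [h1]
      exact (norm_add_le _ _).trans (by gcongr; exact norm_sub_le _ _)
    linarith [hx.2, hv1.2, hv2.2]

/-- The volume of the unit box. -/
def boxConst (d : ℕ) : ℝ≥0∞ := 2 * volume (Metric.ball (0 : EuclideanSpace ℝ (Fin d)) 1)

lemma boxConst_ne_zero (d : ℕ) : boxConst d ≠ 0 :=
  mul_ne_zero (by norm_num) (Metric.measure_ball_pos _ _ one_pos).ne'

lemma boxConst_ne_top (d : ℕ) : boxConst d ≠ ⊤ :=
  ENNReal.mul_ne_top (by norm_num) measure_ball_lt_top.ne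

lemma volume_euclidean_ball (x : EuclideanSpace ℝ (Fin d)) {ρ : ℝ} (hρ : 0 < ρ) :
    volume (Metric.ball x ρ) =
      ENNReal.ofReal ρ ^ d * volume (Metric.ball (0 : EuclideanSpace ℝ (Fin d)) 1) := by
  rw [Measure.addHaar_ball_of_pos _ _ hρ, finrank_euclideanSpace_fin, ENNReal.ofReal_pow hρ.le]

lemma volume_box (z : Spacetime d) {ρ : ℝ} (hρ : 0 < ρ) :
    volume (box z ρ) = boxConst d * ENNReal.ofReal ρ ^ (d + 2) := by
  rw [box, Measure.volume_eq_prod, Measure.prod_prod, Real.volume_ball, volume_euclidean_ball _ hρ,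
    boxConst, ENNReal.ofReal_mul (by norm_num), ENNReal.ofReal_pow hρ.le, pow_add]
  simp only [ENNReal.ofReal_ofNat]
  ring

/-- Vitali's covering lemma for parabolic boxes of bounded radius. -/
lemma exists_disjoint_boxes (t : Set (Spacetime d × ℝ)) (R : ℝ) (hpos : ∀ a ∈ t, 0 < a.2)
    (hR : ∀ a ∈ t, a.2 ≤ R) :
    ∃ u ⊆ t, u.Countable ∧ u.PairwiseDisjoint (fun a => box a.1 a.2) ∧
      ∀ a ∈ t, ∃ b ∈ u, a.2 ≤ 2 * b.2 ∧ box a.1 a.2 ⊆ box b.1 (5 * b.2) := by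
  obtain ⟨u, hut, hdisj, hcov⟩ := Vitali.exists_disjoint_subfamily_covering_enlargement
    (fun a : Spacetime d × ℝ => box a.1 a.2) t (fun a => a.2) 2 one_lt_two
    (fun a ha => (hpos a ha).le) R hR (fun a ha => ⟨a.1, self_mem_box _ (hpos a ha)⟩)
  refine ⟨u, hut, ?_, hdisj, fun a ha => ?_⟩
  · exact hdisj.countable_of_isOpen (fun a _ => isOpen_box _ _)
      (fun a ha => ⟨a.1, self_mem_box _ (hpos a (hut ha))⟩)
  · obtain ⟨b, hb, hne, hle⟩ := hcov a ha
    exact ⟨b, hb, hle, box_subset_of_inter (hpos a ha) hle hne⟩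

/-! ### Maximal functions -/

/-- The uncentred maximal function `sup ρ ^ (-γ) ∫_B f` over the boxes `B ∋ z` of radius `ρ`. -/
def fracMax (γ : ℕ) (f : Spacetime d → ℝ≥0∞) (z : Spacetime d) : ℝ≥0∞ :=
  ⨆ (a : Spacetime d × ℝ) (_ : 0 < a.2),
    (box a.1 a.2).indicator (fun _ => (∫⁻ x in box a.1 a.2, f x) / ENNReal.ofReal a.2 ^ γ) z

/-- The supremum is uncountable, but each member is constant on an open box and zero off it, so the
supremum is lower semicontinuous, even for nonmeasurable `f`. -/
lemma measurable_fracMax (γ : ℕ) (f : Spacetime d → ℝ≥0∞) : Measurable (fracMax γ f) := by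
  refine LowerSemicontinuous.measurable ?_
  refine lowerSemicontinuous_iSup fun a => lowerSemicontinuous_iSup fun _ => ?_
  exact (isOpen_box _ _).lowerSemicontinuous_indicator zero_le

lemma le_fracMax (γ : ℕ) (f : Spacetime d → ℝ≥0∞) {z w : Spacetime d} {ρ : ℝ} (hρ : 0 < ρ)
    (hz : z ∈ box w ρ) :
    (∫⁻ x in box w ρ, f x) / ENNReal.ofReal ρ ^ γ ≤ fracMax γ f z := by
  refine le_iSup₂_of_le (w, ρ) hρ ?_
  simp [hz]

lemma lt_fracMax_iff (γ : ℕ) (f : Spacetime d → ℝ≥0∞) (z : Spacetime d) (c : ℝ≥0∞) :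
    c < fracMax γ f z ↔ ∃ a : Spacetime d × ℝ, 0 < a.2 ∧ z ∈ box a.1 a.2 ∧
      c < (∫⁻ x in box a.1 a.2, f x) / ENNReal.ofReal a.2 ^ γ := by
  simp only [fracMax, lt_iSup_iff]
  constructor
  · rintro ⟨a, ha, h⟩
    by_cases hz : z ∈ box a.1 a.2
    · exact ⟨a, ha, hz, by simpa [hz] using h⟩
    · simp [hz] at h
  · rintro ⟨a, ha, hz, h⟩
    exact ⟨a, ha, by simpa [hz] using h⟩

lemma ofReal_pow_ne_zero {ρ : ℝ} (hρ : 0 < ρ) (γ : ℕ) : ENNReal.ofReal ρ ^ γ ≠ 0 :=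
  pow_ne_zero _ (by simpa using hρ)

lemma ofReal_pow_ne_top (ρ : ℝ) (γ : ℕ) : ENNReal.ofReal ρ ^ γ ≠ ⊤ :=
  ENNReal.pow_ne_top ENNReal.ofReal_ne_top

/-- Weak type `(1, 1)` of the maximal function. -/
lemma mul_volume_lt_fracMax_le (f : Spacetime d → ℝ≥0∞) (c : ℝ≥0∞) :
    c * volume {z | c < fracMax (d + 2) f z} ≤ boxConst d * 5 ^ (d + 2) * ∫⁻ x, f x := by
  -- Vitali's lemma needs bounded radii, so the level set is exhausted by the parts seen by boxes of
  -- radius at most `n`.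
  set Ω : ℕ → Set (Spacetime d) := fun n => {z | ∃ a : Spacetime d × ℝ, 0 < a.2 ∧ a.2 ≤ n ∧
    z ∈ box a.1 a.2 ∧ c < (∫⁻ x in box a.1 a.2, f x) / ENNReal.ofReal a.2 ^ (d + 2)} with hΩ
  have hmono : Monotone Ω := by
    intro m n hmn z
    rintro ⟨a, h1, h2, h3, h4⟩
    exact ⟨a, h1, h2.trans (by exact_mod_cast hmn), h3, h4⟩
  have hunion : {z | c < fracMax (d + 2) f z} = ⋃ n, Ω n := by
    ext z
    simp only [Set.mem_ofPred_eq, lt_fracMax_iff, Set.mem_iUnion, hΩ]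
    constructor
    · rintro ⟨a, h1, h3, h4⟩
      obtain ⟨n, hn⟩ := exists_nat_ge a.2
      exact ⟨n, a, h1, hn, h3, h4⟩
    · rintro ⟨n, a, h1, _, h3, h4⟩
      exact ⟨a, h1, h3, h4⟩
  rw [hunion, hmono.measure_iUnion, ENNReal.mul_iSup]
  refine iSup_le fun n => ?_
  obtain ⟨u, hut, huc, hdisj, hcov⟩ := exists_disjoint_boxes
    {a : Spacetime d × ℝ | 0 < a.2 ∧ a.2 ≤ n ∧
      c < (∫⁻ x in box a.1 a.2, f x) / ENNReal.ofReal a.2 ^ (d + 2)} n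
    (fun a ha => ha.1) (fun a ha => ha.2.1)
  have : Countable u := huc.to_subtype
  have hsub : Ω n ⊆ ⋃ b : u, box b.1.1 (5 * b.1.2) := by
    rintro z ⟨a, h1, h2, h3, h4⟩
    obtain ⟨b, hb, -, hab⟩ := hcov a ⟨h1, h2, h4⟩
    exact Set.mem_iUnion.2 ⟨⟨b, hb⟩, hab h3⟩
  calc c * volume (Ω n) ≤ c * ∑' b : u, volume (box b.1.1 (5 * b.1.2)) := by
        gcongr
        exact (measure_mono hsub).trans (measure_iUnion_le _)
    _ = ∑' b : u, c * volume (box b.1.1 (5 * b.1.2)) := ENNReal.tsum_mul_left.symm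
    _ ≤ ∑' b : u, boxConst d * 5 ^ (d + 2) * ∫⁻ x in box b.1.1 b.1.2, f x := by
        refine ENNReal.tsum_le_tsum fun b => ?_
        obtain ⟨h1, -, h3⟩ := hut b.2
        have h4 := (ENNReal.lt_div_iff_mul_lt (Or.inl (ofReal_pow_ne_zero h1 _))
          (Or.inl (ofReal_pow_ne_top _ _))).1 h3
        rw [volume_box _ (by positivity), ENNReal.ofReal_mul (by norm_num), mul_pow,
          ENNReal.ofReal_ofNat]
        calc _ = boxConst d * 5 ^ (d + 2) * (c * ENNReal.ofReal b.1.2 ^ (d + 2)) := by ring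
          _ ≤ _ := by gcongr
    _ = boxConst d * 5 ^ (d + 2) * ∑' b : u, ∫⁻ x in box b.1.1 b.1.2, f x :=
        ENNReal.tsum_mul_left
    _ = boxConst d * 5 ^ (d + 2) * ∫⁻ x in ⋃ b : u, box b.1.1 b.1.2, f x := by
        rw [lintegral_iUnion (fun b => measurableSet_box _ _)]
        exact fun a b hab => hdisj a.2 b.2 (fun h => hab (Subtype.ext h))
    _ ≤ boxConst d * 5 ^ (d + 2) * ∫⁻ x, f x := by
        exact mul_le_mul_right (setLIntegral_le_lintegral _ _) _

/-- Because `f ≤ f 1_{f > c} + c`. The constant contributes `boxConst d * c` rather than `c`, as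
`fracMax` divides by `ρ ^ (d + 2)` and not by the volume of the box. -/
lemma fracMax_le_add (f : Spacetime d → ℝ≥0∞) (c : ℝ≥0∞) (z : Spacetime d) :
    fracMax (d + 2) f z ≤
      fracMax (d + 2) (fun x => if c < f x then f x else 0) z + boxConst d * c := by
  refine iSup₂_le fun a ha => ?_
  by_cases hz : z ∈ box a.1 a.2
  · rw [Set.indicator_of_mem hz]
    have h1 : ∫⁻ x in box a.1 a.2, f x ≤
        (∫⁻ x in box a.1 a.2, if c < f x then f x else 0) +
          boxConst d * c * ENNReal.ofReal a.2 ^ (d + 2) := by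
      calc ∫⁻ x in box a.1 a.2, f x
          ≤ ∫⁻ x in box a.1 a.2, ((if c < f x then f x else 0) + c) := by
            refine lintegral_mono fun x => ?_
            split_ifs with h
            · exact le_self_add
            · simpa using h
        _ = _ := by
            rw [lintegral_add_right _ measurable_const, setLIntegral_const, volume_box _ ha]
            ring
    calc (∫⁻ x in box a.1 a.2, f x) / ENNReal.ofReal a.2 ^ (d + 2)
        ≤ ((∫⁻ x in box a.1 a.2, if c < f x then f x else 0) +
          boxConst d * c * ENNReal.ofReal a.2 ^ (d + 2)) / ENNReal.ofReal a.2 ^ (d + 2) := by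
          gcongr
      _ ≤ _ := by
          rw [ENNReal.add_div, ENNReal.mul_div_cancel_right (ofReal_pow_ne_zero ha _)
            (ofReal_pow_ne_top _ _)]
          gcongr
          exact le_fracMax _ _ ha hz
  · simp [hz]

/-- The maximal theorem: the maximal function is bounded on `L_s`, `s > 1`. -/
lemma exists_lintegral_fracMax_rpow_le (d : ℕ) {s : ℝ} (hs : 1 < s) :
    ∃ C : ℝ≥0, ∀ f : Spacetime d → ℝ≥0∞, AEMeasurable f volume →
      ∫⁻ z, fracMax (d + 2) f z ^ s ≤ C * ∫⁻ z, f z ^ s := by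
  set κ := boxConst d with hκ
  have hκ0 : κ ≠ 0 := boxConst_ne_zero d
  have hκt : κ ≠ ⊤ := boxConst_ne_top d
  set K : ℝ≥0∞ := (2 * κ) ^ s * (2 ^ s * (5 ^ (d + 2) * geomConst (s - 1))) with hK
  have hKt : K ≠ ⊤ := by
    refine ENNReal.mul_ne_top (ENNReal.rpow_ne_top_of_nonneg (by linarith)
      (ENNReal.mul_ne_top (by norm_num) hκt)) (ENNReal.mul_ne_top
      (ENNReal.rpow_ne_top_of_nonneg (by linarith) (by norm_num)) (ENNReal.mul_ne_top
      (ENNReal.pow_ne_top (by norm_num)) (geomConst_ne_top (by linarith))))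
  refine ⟨K.toNNReal, fun f hf => ?_⟩
  rw [ENNReal.coe_toNNReal hKt]
  set g : ℤ → Spacetime d → ℝ≥0∞ := fun j x => if (2 : ℝ≥0∞) ^ j < f x then f x else 0 with hg
  have hgm : ∀ j, AEMeasurable (g j) volume := fun j =>
    (Measurable.ite measurableSet_Ioi measurable_id measurable_const :
      Measurable fun y : ℝ≥0∞ => if (2 : ℝ≥0∞) ^ j < y then y else 0).comp_aemeasurable hf
  -- Marcinkiewicz splitting: at level `2 κ 2 ^ j` the part of `f` below height `2 ^ j` accounts for
  -- at most `κ 2 ^ j`, so the weak type bound is needed only for `g j`.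
  have hweak : ∀ j : ℤ, (2 : ℝ≥0∞) ^ j * volume {z | 2 ^ j < fracMax (d + 2) f z / (2 * κ)} ≤
      5 ^ (d + 2) * ∫⁻ x, g j x := by
    intro j
    have hsub : {z | 2 ^ j < fracMax (d + 2) f z / (2 * κ)} ⊆
        {z | κ * 2 ^ j < fracMax (d + 2) (g j) z} := by
      intro z hz
      simp only [Set.mem_ofPred_eq] at hz ⊢
      rw [ENNReal.lt_div_iff_mul_lt (Or.inl (mul_ne_zero (by norm_num) hκ0))
        (Or.inl (ENNReal.mul_ne_top (by norm_num) hκt))] at hz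
      have h1 := hz.trans_le (fracMax_le_add f (2 ^ j) z)
      by_contra hcon
      refine absurd h1 (not_lt.2 ?_)
      calc _ ≤ κ * 2 ^ j + κ * 2 ^ j := by
            gcongr
            exact not_lt.1 hcon
        _ = _ := by ring
    have h2 := mul_volume_lt_fracMax_le (g j) (κ * 2 ^ j)
    have h3 : κ * ((2 : ℝ≥0∞) ^ j * volume {z | 2 ^ j < fracMax (d + 2) f z / (2 * κ)}) ≤
        κ * (5 ^ (d + 2) * ∫⁻ x, g j x) := by
      calc _ = κ * 2 ^ j * volume {z | 2 ^ j < fracMax (d + 2) f z / (2 * κ)} := by ring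
        _ ≤ κ * 2 ^ j * volume {z | κ * 2 ^ j < fracMax (d + 2) (g j) z} := by gcongr
        _ ≤ _ := h2
        _ = _ := by ring
    exact (ENNReal.mul_le_mul_iff_right hκ0 hκt).1 h3
  have hmeas : ∀ j : ℤ, MeasurableSet {z | (2 : ℝ≥0∞) ^ j < fracMax (d + 2) f z / (2 * κ)} :=
    fun j => measurableSet_lt measurable_const ((measurable_fracMax _ _).div_const _)
  have hind : ∀ z, layerSum s (fracMax (d + 2) f z / (2 * κ)) =
      ∑' j : ℤ, {z | (2 : ℝ≥0∞) ^ j < fracMax (d + 2) f z / (2 * κ)}.indicator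
        (fun _ => ((2 : ℝ≥0∞) ^ j) ^ s) z := by
    intro z
    simp [layerSum, Set.indicator_apply]
  calc ∫⁻ z, fracMax (d + 2) f z ^ s
      = ∫⁻ z, (2 * κ) ^ s * (fracMax (d + 2) f z / (2 * κ)) ^ s := by
        refine lintegral_congr fun z => ?_
        rw [← ENNReal.mul_rpow_of_nonneg _ _ (by linarith), ENNReal.mul_div_cancel
          (mul_ne_zero (by norm_num) hκ0) (ENNReal.mul_ne_top (by norm_num) hκt)]
    _ ≤ ∫⁻ z, (2 * κ) ^ s * (2 ^ s * ∑' j : ℤ,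
          {z | (2 : ℝ≥0∞) ^ j < fracMax (d + 2) f z / (2 * κ)}.indicator
        (fun _ => ((2 : ℝ≥0∞) ^ j) ^ s) z) := by
        refine lintegral_mono fun z => ?_
        rw [← hind]
        gcongr
        exact rpow_le_layerSum (by linarith) _
    _ = (2 * κ) ^ s * (2 ^ s * ∑' j : ℤ, ((2 : ℝ≥0∞) ^ j) ^ s *
          volume {z | (2 : ℝ≥0∞) ^ j < fracMax (d + 2) f z / (2 * κ)}) := by
        have hm1 : ∀ j : ℤ, Measurable ({z | (2 : ℝ≥0∞) ^ j <
            fracMax (d + 2) f z / (2 * κ)}.indicator (fun _ => ((2 : ℝ≥0∞) ^ j) ^ s)) :=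
          fun j => measurable_const.indicator (hmeas j)
        rw [lintegral_const_mul _ ((Measurable.tsum hm1).const_mul _),
          lintegral_const_mul _ (Measurable.tsum hm1),
          lintegral_tsum fun j => (hm1 j).aemeasurable]
        simp_rw [lintegral_indicator_const (hmeas _)]
    _ ≤ (2 * κ) ^ s * (2 ^ s * ∑' j : ℤ, ((2 : ℝ≥0∞) ^ j) ^ (s - 1) *
          (5 ^ (d + 2) * ∫⁻ x, g j x)) := by
        refine mul_le_mul_right (mul_le_mul_right (ENNReal.tsum_le_tsum fun j => ?_) _) _
        have : ((2 : ℝ≥0∞) ^ j) ^ s = ((2 : ℝ≥0∞) ^ j) ^ (s - 1) * 2 ^ j := by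
          conv_rhs => rw [← ENNReal.rpow_one ((2 : ℝ≥0∞) ^ j), ← ENNReal.rpow_mul, one_mul]
          rw [← ENNReal.rpow_add _ _ (two_zpow_ne_zero j) (two_zpow_ne_top j)]
          simp
        rw [this, mul_assoc]
        exact mul_le_mul_right (hweak j) _
    _ = (2 * κ) ^ s * (2 ^ s * (5 ^ (d + 2) *
          ∫⁻ x, ∑' j : ℤ, ((2 : ℝ≥0∞) ^ j) ^ (s - 1) * g j x)) := by
        rw [lintegral_tsum fun j => (hgm j).const_mul _]
        congr 2
        rw [← ENNReal.tsum_mul_left]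
        refine tsum_congr fun j => ?_
        rw [lintegral_const_mul'' _ (hgm j)]
        ring
    _ ≤ (2 * κ) ^ s * (2 ^ s * (5 ^ (d + 2) * ∫⁻ x, geomConst (s - 1) * f x ^ s)) := by
        gcongr with x
        -- At a fixed point only heights `2 ^ j < f x` contribute; the geometric series converges
        -- because `s - 1 > 0`.
        calc ∑' j : ℤ, ((2 : ℝ≥0∞) ^ j) ^ (s - 1) * g j x = layerSum (s - 1) (f x) * f x := by
              rw [layerSum, ← ENNReal.tsum_mul_right]
              refine tsum_congr fun j => ?_
              simp only [hg]
              split_ifs <;> simp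
          _ ≤ geomConst (s - 1) * f x ^ (s - 1) * f x := by
              gcongr
              exact layerSum_le (by linarith) _
          _ = geomConst (s - 1) * f x ^ s := by
              rw [mul_assoc]
              congr 1
              conv_lhs => rw [← ENNReal.rpow_one (f x), ← ENNReal.rpow_mul, one_mul]
              rw [← ENNReal.rpow_add_of_nonneg _ _ (by linarith) zero_le_one]
              simp
    _ = K * ∫⁻ z, f z ^ s := by
        rw [lintegral_const_mul'' _ (hf.pow_const s), hK]
        ring

/-! ### The dyadic Riesz potential -/

/-- The dyadic form of the parabolic Riesz potential of order one. -/
def rieszSum (f : Spacetime d → ℝ≥0∞) (z : Spacetime d) : ℝ≥0∞ :=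
  ∑' k : ℤ, (∫⁻ x in box z ((2 : ℝ) ^ k), f x) / ((2 : ℝ≥0∞) ^ k) ^ (d + 1)

/-- The part of `rieszSum` over the scales up to `2 ^ K`. -/
def rieszTrunc (K : ℤ) (f : Spacetime d → ℝ≥0∞) (z : Spacetime d) : ℝ≥0∞ :=
  ∑' k : ℤ, if k ≤ K then
    (∫⁻ x in box z ((2 : ℝ) ^ k), f x) / ((2 : ℝ≥0∞) ^ k) ^ (d + 1) else 0

/-- The box is exhausted by products of balls with margin `1 / (n + 1)`. Moving the centre by less
than the margin keeps the smaller set inside the moved box. -/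
lemma lowerSemicontinuous_setLIntegral_box (f : Spacetime d → ℝ≥0∞) (ρ : ℝ) :
    LowerSemicontinuous fun z => ∫⁻ x in box z ρ, f x := by
  intro z c hc
  set S : ℕ → Set (Spacetime d) := fun n => Metric.ball z.1 (ρ ^ 2 - 1 / ((n : ℝ) + 1)) ×ˢ
    Metric.ball z.2 (ρ - 1 / ((n : ℝ) + 1)) with hS
  have hmem : ∀ n w, w ∈ S n ↔ |w.1 - z.1| < ρ ^ 2 - 1 / ((n : ℝ) + 1) ∧
      ‖w.2 - z.2‖ < ρ - 1 / ((n : ℝ) + 1) := by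
    intro n w
    simp [hS, Set.mem_prod, dist_eq_norm]
  have hmono : Monotone S := by
    intro m n hmn w hw
    have := Nat.one_div_le_one_div (α := ℝ) hmn
    rw [hmem] at hw ⊢
    exact ⟨hw.1.trans_le (by linarith), hw.2.trans_le (by linarith)⟩
  have hSm : ∀ n, MeasurableSet (S n) := fun n =>
    measurableSet_ball.prod measurableSet_ball
  have hunion : box z ρ = ⋃ n, S n := by
    ext w
    simp only [mem_box, Set.mem_iUnion, hmem]
    constructor
    · rintro ⟨h1, h2⟩
      obtain ⟨n, hn⟩ := exists_nat_one_div_lt (lt_min (sub_pos.2 h1) (sub_pos.2 h2))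
      have h3 := hn.trans_le (min_le_left _ _)
      have h4 := hn.trans_le (min_le_right _ _)
      exact ⟨n, by linarith, by linarith⟩
    · rintro ⟨n, h1, h2⟩
      have : 0 < 1 / ((n : ℝ) + 1) := Nat.one_div_pos_of_nat
      exact ⟨by linarith, by linarith⟩
  have h1 : ∫⁻ x in box z ρ, f x = ⨆ n, ∫⁻ x in S n, f x := by
    -- Continuity from below is applied to the measure `volume.withDensity f`, which asks for no
    -- measurability of `f`.
    rw [← withDensity_apply f (measurableSet_box z ρ), hunion, hmono.measure_iUnion]
    exact iSup_congr fun n => withDensity_apply f (hSm n)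
  simp only [h1, gt_iff_lt, lt_iSup_iff] at hc
  obtain ⟨n, hn⟩ := hc
  have hpos : 0 < 1 / ((n : ℝ) + 1) := Nat.one_div_pos_of_nat
  filter_upwards [Metric.ball_mem_nhds z hpos] with z' hz'
  refine hn.trans_le (lintegral_mono_set ?_)
  intro w hw
  rw [hmem] at hw
  rw [Metric.mem_ball, Prod.dist_eq, max_lt_iff, Real.dist_eq, dist_eq_norm] at hz'
  rw [mem_box]
  constructor
  · have h2 := abs_sub_le w.1 z.1 z'.1
    rw [abs_sub_comm z.1] at h2
    linarith [hw.1, hz'.1]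
  · have h2 := norm_sub_le_norm_sub_add_norm_sub w.2 z.2 z'.2
    rw [norm_sub_rev z.2] at h2
    linarith [hw.2, hz'.2]

lemma measurable_rieszTrunc (K : ℤ) (f : Spacetime d → ℝ≥0∞) : Measurable (rieszTrunc K f) := by
  refine Measurable.tsum fun k => ?_
  split_ifs
  · exact (lowerSemicontinuous_setLIntegral_box f _).measurable.div_const _
  · exact measurable_const

lemma measurable_rieszSum (f : Spacetime d → ℝ≥0∞) : Measurable (rieszSum f) :=
  Measurable.tsum fun _ => (lowerSemicontinuous_setLIntegral_box f _).measurable.div_const _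

lemma monotone_rieszTrunc (f : Spacetime d → ℝ≥0∞) (z : Spacetime d) :
    Monotone fun n : ℕ => rieszTrunc n f z := by
  intro m n hmn
  refine ENNReal.tsum_le_tsum fun k => ?_
  split_ifs with h1 h2
  · exact le_rfl
  · omega
  · exact zero_le
  · exact le_rfl

lemma rieszSum_eq_iSup (f : Spacetime d → ℝ≥0∞) (z : Spacetime d) :
    rieszSum f z = ⨆ n : ℕ, rieszTrunc n f z := by
  apply le_antisymm
  · rw [rieszSum, ENNReal.tsum_eq_iSup_sum]
    refine iSup_le fun s => ?_
    obtain ⟨n, hn⟩ : ∃ n : ℕ, ∀ k ∈ s, k ≤ (n : ℤ) := by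
      obtain ⟨M, hM⟩ := s.bddAbove
      exact ⟨M.toNat, fun k hk => (hM hk).trans (Int.self_le_toNat M)⟩
    refine le_iSup_of_le n (le_trans (le_of_eq ?_) (ENNReal.sum_le_tsum s))
    exact Finset.sum_congr rfl fun k hk => (if_pos (hn k hk)).symm
  · refine iSup_le fun n => ENNReal.tsum_le_tsum fun k => ?_
    split_ifs
    · exact le_rfl
    · exact zero_le

/-- A sum of dyadic scales, each with a large average, is controlled by a disjoint family. -/
lemma exists_boxes_tsum_le (f : Spacetime d → ℝ≥0∞) (K : ℤ) (c : ℝ≥0∞) :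
    ∃ u : Set (Spacetime d × ℝ), u.Countable ∧ (∀ b ∈ u, 0 < b.2) ∧
      u.PairwiseDisjoint (fun a => box a.1 a.2) ∧
      (∀ b ∈ u, box b.1 b.2 ⊆ {z | c < fracMax (d + 2) f z}) ∧
      ∀ z, ∑' k : ℤ, (if k ≤ K ∧ c < (∫⁻ x in box z ((2 : ℝ) ^ k), f x) /
          ((2 : ℝ≥0∞) ^ k) ^ (d + 2) then (2 : ℝ≥0∞) ^ k else 0) ≤
        2 * geomConst 1 * ∑' b : u, (box b.1.1 (5 * b.1.2)).indicator
          (fun _ => ENNReal.ofReal b.1.2) z := by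
  obtain ⟨u, hut, huc, hdisj, hcov⟩ := exists_disjoint_boxes
    {a : Spacetime d × ℝ | ∃ k : ℤ, k ≤ K ∧ a.2 = (2 : ℝ) ^ k ∧
      c < (∫⁻ x in box a.1 a.2, f x) / ENNReal.ofReal a.2 ^ (d + 2)} ((2 : ℝ) ^ K)
    (by rintro a ⟨k, -, h, -⟩; rw [h]; positivity)
    (by rintro a ⟨k, hk, h, -⟩; rw [h]; exact zpow_le_zpow_right₀ one_le_two hk)
  have hpos : ∀ b ∈ u, 0 < b.2 := by
    intro b hb
    obtain ⟨k, -, h, -⟩ := hut hb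
    rw [h]
    positivity
  refine ⟨u, huc, hpos, hdisj, ?_, fun z => ?_⟩
  · intro b hb z hz
    obtain ⟨k, -, -, h⟩ := hut hb
    exact h.trans_le (le_fracMax _ _ (hpos b hb) hz)
  · set P : ℤ → Prop := fun k => k ≤ K ∧ c < (∫⁻ x in box z ((2 : ℝ) ^ k), f x) /
          ((2 : ℝ≥0∞) ^ k) ^ (d + 2) with hP
    by_cases hex : ∃ k, P k
    -- The bound `K` gives a largest admissible scale `n`, which dominates the sum up to `geomConst
    -- 1`. The box selected for `(z, 2 ^ n)` has radius at least `2 ^ n / 2` and its enlargement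
    -- contains `z`, so a single term on the right suffices.
    · obtain ⟨n, hn, hmax⟩ := Int.exists_greatest_of_bdd ⟨K, fun k hk => hk.1⟩ hex
      obtain ⟨b, hb, hle, hsub⟩ := hcov (z, (2 : ℝ) ^ n) ⟨n, hn.1, rfl, by
        simpa [ofReal_two_zpow] using hn.2⟩
      have hz : z ∈ box b.1 (5 * b.2) := hsub (self_mem_box z (by positivity))
      have hle' : (2 : ℝ≥0∞) ^ n ≤ 2 * ENNReal.ofReal b.2 := by
        rw [← ofReal_two_zpow]
        refine (ENNReal.ofReal_le_ofReal hle).trans ?_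
        rw [ENNReal.ofReal_mul (by norm_num), ENNReal.ofReal_ofNat]
      calc ∑' k : ℤ, (if P k then (2 : ℝ≥0∞) ^ k else 0)
          ≤ ∑' k : ℤ, (if k ≤ n then ((2 : ℝ≥0∞) ^ k) ^ (1 : ℝ) else 0) := by
            refine ENNReal.tsum_le_tsum fun k => ?_
            split_ifs with h1 h2
            · simp
            · exact absurd (hmax k h1) h2
            · exact zero_le
            · exact le_rfl
        _ = geomConst 1 * 2 ^ n := by rw [tsum_zpow_le, ENNReal.rpow_one]
        _ ≤ geomConst 1 * (2 * ENNReal.ofReal b.2) := by gcongr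
        _ = 2 * geomConst 1 * (box b.1 (5 * b.2)).indicator
              (fun _ => ENNReal.ofReal b.2) z := by
            rw [Set.indicator_of_mem hz]
            ring
        _ ≤ _ := by
            gcongr
            exact ENNReal.le_tsum (f := fun b : u => (box b.1.1 (5 * b.1.2)).indicator
              (fun _ => ENNReal.ofReal b.1.2) z) ⟨b, hb⟩
    · push Not at hex
      rw [ENNReal.tsum_eq_zero.2 fun k => if_neg (hex k)]
      exact zero_le

/-- Every `x` in the small box lies in the enlarged one, so `fracMax (d + 1) h x` is at least `(5 ρ)
^ (-(d + 1))` times the integral of `h` there. Integrating this over the small box, of volume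
`boxConst d * ρ ^ (d + 2)`, leaves one factor `ρ`. -/
lemma ofReal_mul_setLIntegral_le (h : Spacetime d → ℝ≥0∞) (w : Spacetime d) {ρ : ℝ} (hρ : 0 < ρ) :
    ENNReal.ofReal ρ * ∫⁻ x in box w (5 * ρ), h x ≤
      5 ^ (d + 1) * (boxConst d)⁻¹ * ∫⁻ x in box w ρ, fracMax (d + 1) h x := by
  set I := ∫⁻ x in box w (5 * ρ), h x
  set r := ENNReal.ofReal ρ with hr
  have hr0 : r ≠ 0 := by simpa [hr] using hρ
  have hrt : r ≠ ⊤ := ENNReal.ofReal_ne_top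
  have h5 : (5 : ℝ≥0∞) ^ (d + 1) ≠ 0 := pow_ne_zero _ (by norm_num)
  have h5t : (5 : ℝ≥0∞) ^ (d + 1) ≠ ⊤ := ENNReal.pow_ne_top (by norm_num)
  have h1 : I / (5 * r) ^ (d + 1) * (boxConst d * r ^ (d + 2)) ≤
      ∫⁻ x in box w ρ, fracMax (d + 1) h x := by
    rw [← volume_box w hρ, ← setLIntegral_const]
    refine setLIntegral_mono (measurable_fracMax _ _) fun x hx => ?_
    have h2 := le_fracMax (d + 1) h (w := w) (ρ := 5 * ρ) (by positivity)
      (box_mono w hρ.le (by linarith) hx)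
    rwa [ENNReal.ofReal_mul (by norm_num), ENNReal.ofReal_ofNat] at h2
  refine le_trans (le_of_eq ?_) (mul_le_mul_right h1 _)
  have e1 : (5 : ℝ≥0∞) ^ (d + 1) * (5 ^ (d + 1))⁻¹ = 1 := ENNReal.mul_inv_cancel h5 h5t
  have e2 : (r ^ (d + 1)) * (r ^ (d + 1))⁻¹ = 1 :=
    ENNReal.mul_inv_cancel (pow_ne_zero _ hr0) (ENNReal.pow_ne_top hrt)
  have e3 : (boxConst d)⁻¹ * boxConst d = 1 :=
    ENNReal.inv_mul_cancel (boxConst_ne_zero d) (boxConst_ne_top d)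
  rw [mul_pow, ENNReal.div_eq_inv_mul, ENNReal.mul_inv (Or.inl h5) (Or.inl h5t)]
  calc r * I = ((5 : ℝ≥0∞) ^ (d + 1) * (5 ^ (d + 1))⁻¹) * ((r ^ (d + 1)) * (r ^ (d + 1))⁻¹) *
        ((boxConst d)⁻¹ * boxConst d) * (r * I) := by rw [e1, e2, e3]; ring
    _ = _ := by ring

/-- Each term is `2 ^ k` times `a`, the integral over the box divided by `2 ^ (k (d + 2))`.
Decomposing `a` into dyadic layers and exchanging the sums groups the scales by height `2 ^ j`. -/
lemma rieszTrunc_le_tsum (K : ℤ) (f : Spacetime d → ℝ≥0∞) (z : Spacetime d) :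
    rieszTrunc K f z ≤ 2 * ∑' j : ℤ, (2 : ℝ≥0∞) ^ j * ∑' k : ℤ,
      (if k ≤ K ∧ (2 : ℝ≥0∞) ^ j < (∫⁻ x in box z ((2 : ℝ) ^ k), f x) /
          ((2 : ℝ≥0∞) ^ k) ^ (d + 2) then (2 : ℝ≥0∞) ^ k else 0) := by
  simp_rw [← ENNReal.tsum_mul_left]
  rw [ENNReal.tsum_comm]
  refine ENNReal.tsum_le_tsum fun k => ?_
  split_ifs with hk
  · set a := (∫⁻ x in box z ((2 : ℝ) ^ k), f x) / ((2 : ℝ≥0∞) ^ k) ^ (d + 2) with ha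
    have h1 : (∫⁻ x in box z ((2 : ℝ) ^ k), f x) / ((2 : ℝ≥0∞) ^ k) ^ (d + 1) = a * 2 ^ k := by
      rw [ha, ENNReal.div_eq_inv_mul, ENNReal.div_eq_inv_mul, pow_succ _ (d + 1),
        ENNReal.mul_inv (Or.inr (two_zpow_ne_top k)) (Or.inr (two_zpow_ne_zero k))]
      calc _ = (((2 : ℝ≥0∞) ^ k) ^ (d + 1))⁻¹ * (∫⁻ x in box z ((2 : ℝ) ^ k), f x) *
            (((2 : ℝ≥0∞) ^ k)⁻¹ * 2 ^ k) := by
            rw [ENNReal.inv_mul_cancel (two_zpow_ne_zero k) (two_zpow_ne_top k), mul_one]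
        _ = _ := by ring
    rw [h1]
    have h2 := rpow_le_layerSum one_pos a
    rw [ENNReal.rpow_one, ENNReal.rpow_one] at h2
    calc a * 2 ^ k ≤ 2 * layerSum 1 a * 2 ^ k := by gcongr
      _ = _ := by
        rw [layerSum, ← ENNReal.tsum_mul_left, ← ENNReal.tsum_mul_right]
        refine tsum_congr fun j => ?_
        by_cases hj : (2 : ℝ≥0∞) ^ j < a
        · simp [hj, hk]
          ring
        · simp [hj]
  · exact zero_le

/-- The pairing of a Riesz potential is controlled by the maximal functions. -/
lemma exists_lintegral_mul_rieszTrunc_le (d : ℕ) :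
    ∃ C : ℝ≥0, ∀ f h : Spacetime d → ℝ≥0∞, AEMeasurable h volume → ∀ K : ℤ,
      ∫⁻ z, h z * rieszTrunc K f z ≤
        C * ∫⁻ z, fracMax (d + 2) f z * fracMax (d + 1) h z := by
  set g := geomConst 1 with hg
  have hgt : g ≠ ⊤ := geomConst_ne_top one_pos
  set D : ℝ≥0∞ := 5 ^ (d + 1) * (boxConst d)⁻¹ with hD
  have hDt : D ≠ ⊤ := ENNReal.mul_ne_top (ENNReal.pow_ne_top (by norm_num))
    (ENNReal.inv_ne_top.2 (boxConst_ne_zero d))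
  set C : ℝ≥0∞ := 2 * (2 * g) * D * g with hC
  have hCt : C ≠ ⊤ := by
    refine ENNReal.mul_ne_top (ENNReal.mul_ne_top (ENNReal.mul_ne_top (by norm_num)
      (ENNReal.mul_ne_top (by norm_num) hgt)) hDt) hgt
  refine ⟨C.toNNReal, fun f h hh K => ?_⟩
  rw [ENNReal.coe_toNNReal hCt]
  choose u huc hpos hdisj hsub hle using fun j : ℤ => exists_boxes_tsum_le f K ((2 : ℝ≥0∞) ^ j)
  have : ∀ j, Countable (u j) := fun j => (huc j).to_subtype
  have hm : ∀ j (b : u j), AEMeasurable (fun z => h z * (box b.1.1 (5 * b.1.2)).indicator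
      (fun _ => ENNReal.ofReal b.1.2) z) volume := fun j b =>
    hh.mul (measurable_const.indicator (measurableSet_box _ _)).aemeasurable
  have hm2 : ∀ j, AEMeasurable (fun z => ∑' b : u j, h z * (box b.1.1 (5 * b.1.2)).indicator
      (fun _ => ENNReal.ofReal b.1.2) z) volume := fun j => AEMeasurable.tsum (hm j)
  have hmM : ∀ j : ℤ, MeasurableSet {z | (2 : ℝ≥0∞) ^ j < fracMax (d + 2) f z} := fun j =>
    measurableSet_lt measurable_const (measurable_fracMax _ _)
  -- The enlarged boxes may overlap, but each is traded for its original box; these are disjoint and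
  -- lie in the level set of `fracMax (d + 2) f`.
  have hlevel : ∀ j : ℤ, ∫⁻ z, ∑' b : u j, h z * (box b.1.1 (5 * b.1.2)).indicator
      (fun _ => ENNReal.ofReal b.1.2) z ≤
      D * ∫⁻ z, {z | (2 : ℝ≥0∞) ^ j < fracMax (d + 2) f z}.indicator (fracMax (d + 1) h) z := by
    intro j
    rw [lintegral_tsum (hm j), lintegral_indicator (hmM j)]
    calc ∑' b : u j, ∫⁻ z, h z * (box b.1.1 (5 * b.1.2)).indicator
          (fun _ => ENNReal.ofReal b.1.2) z
        = ∑' b : u j, ENNReal.ofReal b.1.2 * ∫⁻ x in box b.1.1 (5 * b.1.2), h x := by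
          refine tsum_congr fun b => ?_
          rw [← lintegral_const_mul'' _ hh.restrict, ← lintegral_indicator (measurableSet_box _ _)]
          refine lintegral_congr fun z => ?_
          by_cases hz : z ∈ box b.1.1 (5 * b.1.2) <;> simp [hz, mul_comm (h z)]
      _ ≤ ∑' b : u j, D * ∫⁻ x in box b.1.1 b.1.2, fracMax (d + 1) h x :=
          ENNReal.tsum_le_tsum fun b => ofReal_mul_setLIntegral_le h _ (hpos j b.1 b.2)
      _ = D * ∫⁻ x in ⋃ b : u j, box b.1.1 b.1.2, fracMax (d + 1) h x := by
          rw [ENNReal.tsum_mul_left, lintegral_iUnion (fun b => measurableSet_box _ _)]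
          exact fun a b hab => hdisj j a.2 b.2 (fun h => hab (Subtype.ext h))
      _ ≤ D * ∫⁻ z in {z | (2 : ℝ≥0∞) ^ j < fracMax (d + 2) f z}, fracMax (d + 1) h z := by
          have hss : (⋃ b : u j, box b.1.1 b.1.2) ⊆ {z | (2 : ℝ≥0∞) ^ j < fracMax (d + 2) f z} :=
            Set.iUnion_subset fun b => hsub j b.1 b.2
          exact mul_le_mul_right (lintegral_mono_set hss) D
  calc ∫⁻ z, h z * rieszTrunc K f z
      ≤ ∫⁻ z, (2 * (2 * g)) * ∑' j : ℤ, (2 : ℝ≥0∞) ^ j * ∑' b : u j, h z *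
          (box b.1.1 (5 * b.1.2)).indicator (fun _ => ENNReal.ofReal b.1.2) z := by
        refine lintegral_mono fun z => ?_
        simp only
        calc h z * rieszTrunc K f z ≤ h z * (2 * ∑' j : ℤ, (2 : ℝ≥0∞) ^ j * (2 * g *
              ∑' b : u j, (box b.1.1 (5 * b.1.2)).indicator
                (fun _ => ENNReal.ofReal b.1.2) z)) := by
              refine mul_le_mul_right ((rieszTrunc_le_tsum K f z).trans ?_) _
              exact mul_le_mul_right
                (ENNReal.tsum_le_tsum fun j => mul_le_mul_right (hle j z) _) _
          _ = _ := by
              simp_rw [ENNReal.tsum_mul_left, mul_left_comm _ (2 * g), ENNReal.tsum_mul_left,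
                mul_left_comm _ (h z), ENNReal.tsum_mul_left]
              ring
    _ = (2 * (2 * g)) * ∑' j : ℤ, (2 : ℝ≥0∞) ^ j * ∫⁻ z, ∑' b : u j, h z *
          (box b.1.1 (5 * b.1.2)).indicator (fun _ => ENNReal.ofReal b.1.2) z := by
        rw [lintegral_const_mul'' _ (AEMeasurable.tsum fun j => (hm2 j).const_mul _),
          lintegral_tsum fun j => (hm2 j).const_mul _]
        simp_rw [lintegral_const_mul'' _ (hm2 _)]
    _ ≤ (2 * (2 * g)) * ∑' j : ℤ, (2 : ℝ≥0∞) ^ j * (D *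
          ∫⁻ z, {z | (2 : ℝ≥0∞) ^ j < fracMax (d + 2) f z}.indicator (fracMax (d + 1) h) z) :=
        mul_le_mul_right (ENNReal.tsum_le_tsum fun j => mul_le_mul_right (hlevel j) _) _
    -- Summing `2 ^ j` over the level sets rebuilds `fracMax (d + 2) f`, up to a constant.
    _ = (2 * (2 * g)) * D * ∫⁻ z, layerSum 1 (fracMax (d + 2) f z) * fracMax (d + 1) h z := by
        have hm3 : ∀ j : ℤ, Measurable ({z | (2 : ℝ≥0∞) ^ j < fracMax (d + 2) f z}.indicator
          (fracMax (d + 1) h)) := fun j => (measurable_fracMax _ _).indicator (hmM j)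
        simp_rw [mul_left_comm _ D, ENNReal.tsum_mul_left, ← mul_assoc]
        congr 1
        simp_rw [← lintegral_const_mul _ (hm3 _)]
        rw [← lintegral_tsum fun j => ((hm3 j).const_mul _).aemeasurable]
        refine lintegral_congr fun z => ?_
        rw [layerSum, ← ENNReal.tsum_mul_right]
        refine tsum_congr fun j => ?_
        simp only [Set.indicator_apply, Set.mem_ofPred_eq]
        split_ifs <;> simp
    _ ≤ (2 * (2 * g)) * D * ∫⁻ z, g * (fracMax (d + 2) f z * fracMax (d + 1) h z) := by
        refine mul_le_mul_right (lintegral_mono fun z => ?_) _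
        rw [← mul_assoc]
        gcongr
        simpa using layerSum_le one_pos (fracMax (d + 2) f z)
    _ = C * ∫⁻ z, fracMax (d + 2) f z * fracMax (d + 1) h z := by
        rw [lintegral_const_mul' _ _ hgt, hC]
        ring

/-- The truncation only served to bound the radii; the constant does not depend on it, so monotone
convergence removes it. -/
lemma exists_lintegral_mul_rieszSum_le (d : ℕ) :
    ∃ C : ℝ≥0, ∀ f h : Spacetime d → ℝ≥0∞, AEMeasurable h volume →
      ∫⁻ z, h z * rieszSum f z ≤ C * ∫⁻ z, fracMax (d + 2) f z * fracMax (d + 1) h z := by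
  obtain ⟨C, hC⟩ := exists_lintegral_mul_rieszTrunc_le d
  refine ⟨C, fun f h hh => ?_⟩
  simp_rw [rieszSum_eq_iSup, ENNReal.mul_iSup]
  rw [lintegral_iSup' (f := fun (n : ℕ) z => h z * rieszTrunc n f z)
    (fun n => hh.mul (measurable_rieszTrunc _ f).aemeasurable)
    (Filter.Eventually.of_forall fun z m n hmn =>
      mul_le_mul_right (monotone_rieszTrunc f z hmn) _)]
  exact iSup_le fun n => hC f h hh n

/-! ### Morrey functions -/

lemma volume_paraCylinder (z : Spacetime d) {ρ : ℝ} (hρ : 0 < ρ) :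
    volume (paraCylinder ρ z) = ENNReal.ofReal ρ ^ (d + 2) *
      volume (Metric.ball (0 : EuclideanSpace ℝ (Fin d)) 1) := by
  have h : paraCylinder ρ z = Set.Ico z.1 (z.1 + ρ ^ 2) ×ˢ Metric.ball z.2 ρ := by
    ext w
    simp only [paraCylinder, Set.mem_ofPred_eq, Set.mem_prod, Set.mem_Ico, Metric.mem_ball,
      dist_eq_norm, norm_sub_rev z.2]
    tauto
  rw [h, Measure.volume_eq_prod, Measure.prod_prod, Real.volume_Ico, volume_euclidean_ball _ hρ,
    add_sub_cancel_left, ENNReal.ofReal_pow hρ.le, pow_add]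
  ring

/-- The cylinder extends only forward in time, so its vertex is moved back by `ρ ^ 2`; its time
length `4 ρ ^ 2` then covers the `2 ρ ^ 2` of the box. -/
lemma box_subset_paraCylinder (z : Spacetime d) (ρ : ℝ) :
    box z ρ ⊆ paraCylinder (2 * ρ) (z.1 - ρ ^ 2, z.2) := by
  intro w hw
  rw [mem_box, abs_lt] at hw
  have h0 : 0 ≤ ‖w.2 - z.2‖ := norm_nonneg _
  refine ⟨?_, ?_, ?_⟩
  · simp only
    rw [norm_sub_rev]
    linarith [hw.2]
  · simp only
    linarith [hw.1.1]
  · simp only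
    nlinarith [hw.1.2, sq_nonneg ρ]

lemma exists_box_le_morreyNorm (d : ℕ) {q : ℝ} (hq : 1 < q) :
    ∃ C : ℝ≥0, ∀ (m : ℕ) (b : Spacetime d → EuclideanSpace ℝ (Fin m)) (z : Spacetime d) (ρ : ℝ),
      0 < ρ → ENNReal.ofReal ρ * (∫⁻ x in box z ρ, ‖b x‖ₑ ^ q) ^ (1 / q) ≤
        C * morreyNorm q 1 b * (ENNReal.ofReal ρ ^ (d + 2)) ^ (1 / q) := by
  have hq0 : 0 ≤ 1 / q := by positivity
  set β := volume (Metric.ball (0 : EuclideanSpace ℝ (Fin d)) 1) with hβ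
  have hβ0 : β ≠ 0 := (Metric.measure_ball_pos _ _ one_pos).ne'
  have hβt : β ≠ ⊤ := measure_ball_lt_top.ne
  set C : ℝ≥0∞ := (2 ^ (d + 2) * β) ^ (1 / q) with hC
  have hCt : C ≠ ⊤ := ENNReal.rpow_ne_top_of_nonneg hq0
    (ENNReal.mul_ne_top (ENNReal.pow_ne_top (by norm_num)) hβt)
  refine ⟨C.toNNReal, fun m b z ρ hρ => ?_⟩
  rw [ENNReal.coe_toNNReal hCt]
  set V := volume (paraCylinder (2 * ρ) (z.1 - ρ ^ 2, z.2)) with hV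
  have hVeq : V = 2 ^ (d + 2) * β * ENNReal.ofReal ρ ^ (d + 2) := by
    rw [hV, volume_paraCylinder _ (by positivity), ENNReal.ofReal_mul (by norm_num), mul_pow,
      ENNReal.ofReal_ofNat]
    ring
  have hV0 : V ≠ 0 := by
    rw [hVeq]
    exact mul_ne_zero (mul_ne_zero (pow_ne_zero _ (by norm_num)) hβ0) (ofReal_pow_ne_zero hρ _)
  have hVt : V ≠ ⊤ := by
    rw [hVeq]
    exact ENNReal.mul_ne_top (ENNReal.mul_ne_top (ENNReal.pow_ne_top (by norm_num)) hβt)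
      (ofReal_pow_ne_top _ _)
  have h1 : ENNReal.ofReal ρ * ((∫⁻ x in box z ρ, ‖b x‖ₑ ^ q) / V) ^ (1 / q) ≤
      morreyNorm q 1 b := by
    refine le_trans ?_ (le_iSup₂_of_le (2 * ρ) (by positivity)
      (le_iSup_of_le (z.1 - ρ ^ 2, z.2) le_rfl))
    rw [setLAverage_eq, Real.rpow_one]
    gcongr
    · linarith
    · exact box_subset_paraCylinder z ρ
  have h2 : (V : ℝ≥0∞) ^ (1 / q) ≠ 0 := by
    simp [ENNReal.rpow_eq_zero_iff, hV0, hVt]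
  calc ENNReal.ofReal ρ * (∫⁻ x in box z ρ, ‖b x‖ₑ ^ q) ^ (1 / q)
      = ENNReal.ofReal ρ * ((∫⁻ x in box z ρ, ‖b x‖ₑ ^ q) / V) ^ (1 / q) * V ^ (1 / q) := by
        rw [mul_assoc, ← ENNReal.mul_rpow_of_nonneg _ _ hq0, ENNReal.div_mul_cancel hV0 hVt]
    _ ≤ morreyNorm q 1 b * V ^ (1 / q) := by gcongr
    _ = _ := by
        rw [hVeq, ENNReal.mul_rpow_of_nonneg _ _ hq0, ← hC]
        ring

/-- The fractional maximal function of a product with a Morrey function. -/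
lemma exists_fracMax_mul_le (d : ℕ) {q q' : ℝ} (hqq : q.HolderConjugate q') :
    ∃ C : ℝ≥0, ∀ (m : ℕ) (b : Spacetime d → EuclideanSpace ℝ (Fin m)),
      AEStronglyMeasurable b volume → ∀ g : Spacetime d → ℝ≥0∞, AEMeasurable g volume →
      ∀ z, fracMax (d + 1) (fun x => ‖b x‖ₑ * g x) z ≤
        C * morreyNorm q 1 b * fracMax (d + 2) (fun x => g x ^ q') z ^ (1 / q') := by
  obtain ⟨C, hC⟩ := exists_box_le_morreyNorm d hqq.lt
  refine ⟨C, fun m b hb g hg z => iSup₂_le fun a ha => ?_⟩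
  by_cases hz : z ∈ box a.1 a.2
  swap
  · simp [hz]
  rw [Set.indicator_of_mem hz]
  set r := ENNReal.ofReal a.2 with hr
  set A := morreyNorm q 1 b
  set M := fracMax (d + 2) (fun x => g x ^ q') z
  have hr0 : r ≠ 0 := by simpa [hr] using ha
  have hrt : r ≠ ⊤ := ENNReal.ofReal_ne_top
  have hq'0 : 0 ≤ 1 / q' := one_div_nonneg.2 hqq.symm.nonneg
  have h1 : ∫⁻ x in box a.1 a.2, ‖b x‖ₑ * g x ≤
      (∫⁻ x in box a.1 a.2, ‖b x‖ₑ ^ q) ^ (1 / q) *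
        (∫⁻ x in box a.1 a.2, g x ^ q') ^ (1 / q') :=
    ENNReal.lintegral_mul_le_Lp_mul_Lq _ hqq hb.enorm.restrict hg.restrict
  have h2 : (∫⁻ x in box a.1 a.2, g x ^ q') ^ (1 / q') ≤
      (r ^ (d + 2)) ^ (1 / q') * M ^ (1 / q') := by
    rw [← ENNReal.mul_rpow_of_nonneg _ _ hq'0]
    gcongr
    rw [mul_comm]
    exact (ENNReal.div_le_iff (pow_ne_zero _ hr0) (ENNReal.pow_ne_top hrt)).1
      (le_fracMax (d + 2) (fun x => g x ^ q') ha hz)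
  rw [ENNReal.div_le_iff (pow_ne_zero _ hr0) (ENNReal.pow_ne_top hrt)]
  -- The normalisation `r ^ (d + 1)` lacks one factor `r` to be `r ^ (d + 2)`; that factor is the
  -- weight `ρ` in the Morrey norm.
  refine (ENNReal.mul_le_mul_iff_right hr0 hrt).1 ?_
  calc r * ∫⁻ x in box a.1 a.2, ‖b x‖ₑ * g x
      ≤ r * ((∫⁻ x in box a.1 a.2, ‖b x‖ₑ ^ q) ^ (1 / q) *
        ((r ^ (d + 2)) ^ (1 / q') * M ^ (1 / q'))) := by
        gcongr
        exact h1.trans (mul_le_mul_right h2 _)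
    _ = r * (∫⁻ x in box a.1 a.2, ‖b x‖ₑ ^ q) ^ (1 / q) *
        ((r ^ (d + 2)) ^ (1 / q') * M ^ (1 / q')) := by ring
    _ ≤ C * A * (r ^ (d + 2)) ^ (1 / q) * ((r ^ (d + 2)) ^ (1 / q') * M ^ (1 / q')) :=
        mul_le_mul_left (hC m b a.1 a.2 ha) _
    _ = C * A * M ^ (1 / q') * ((r ^ (d + 2)) ^ (1 / q) * (r ^ (d + 2)) ^ (1 / q')) := by ring
    _ = C * A * M ^ (1 / q') * r ^ (d + 2) := by
        rw [← ENNReal.rpow_add _ _ (pow_ne_zero _ hr0) (ENNReal.pow_ne_top hrt), one_div, one_div,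
          hqq.inv_add_inv_eq_one, ENNReal.rpow_one]
    _ = _ := by ring

/-! ### Duality -/

/-- Division by `X ^ (1 / p')` leaves `X ^ (1 / p) ≤ D`. It requires `X` finite, which is why
truncated functions are used below. -/
lemma le_rpow_of_le_mul_rpow {p p' : ℝ} (hpp : p.HolderConjugate p') {X D : ℝ≥0∞} (hX : X ≠ ⊤)
    (h : X ≤ D * X ^ (1 / p')) : X ≤ D ^ p := by
  rcases eq_or_ne X 0 with rfl | h0
  · exact zero_le
  have hp' : X ^ (1 / p') ≠ 0 := by simp [ENNReal.rpow_eq_zero_iff, h0, hX]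
  have hpt : X ^ (1 / p') ≠ ⊤ :=
    ENNReal.rpow_ne_top_of_nonneg (one_div_nonneg.2 hpp.symm.nonneg) hX
  have h1 : X ^ (1 / p) * X ^ (1 / p') ≤ D * X ^ (1 / p') := by
    rwa [← ENNReal.rpow_add _ _ h0 hX, one_div, one_div, hpp.inv_add_inv_eq_one, ENNReal.rpow_one,
      ← one_div]
  have h2 : X ^ p⁻¹ ≤ D := by
    rw [← one_div]
    exact (ENNReal.mul_le_mul_iff_left hp' hpt).1 h1
  exact (ENNReal.rpow_inv_le_iff hpp.pos).1 h2

/-- A function that pairs boundedly with `L_{p'}` is in `L_p`. -/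
lemma lintegral_rpow_le_of_forall_pairing {α : Type*} [MeasurableSpace α] {μ : Measure α}
    [SigmaFinite μ] {p p' : ℝ} (hpp : p.HolderConjugate p') {w : α → ℝ≥0∞}
    (hw : AEMeasurable w μ) (D : ℝ≥0∞)
    (h : ∀ g : α → ℝ≥0∞, AEMeasurable g μ →
      ∫⁻ x, g x * w x ∂μ ≤ D * (∫⁻ x, g x ^ p' ∂μ) ^ (1 / p')) :
    ∫⁻ x, w x ^ p ∂μ ≤ D ^ p := by
  classical
  set v : ℕ → α → ℝ≥0∞ := fun n => (spanningSets μ n).indicator fun x => min (w x) n with hv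
  have hvm : ∀ n, AEMeasurable (v n) μ := fun n =>
    (hw.min aemeasurable_const).indicator (measurableSet_spanningSets μ n)
  have hvw : ∀ n x, v n x ≤ w x := by
    intro n x
    refine (Set.indicator_le_self _ _ x).trans (min_le_left _ _)
  have hmono : ∀ x, Monotone fun n => v n x := by
    intro x m n hmn
    simp only [hv, Set.indicator_apply]
    split_ifs with h1 h2
    · exact min_le_min le_rfl (by exact_mod_cast hmn)
    · exact absurd (monotone_spanningSets μ hmn h1) h2
    · exact zero_le
    · exact le_rfl
  have hlim : ∀ x, Filter.Tendsto (fun n => v n x) Filter.atTop (nhds (w x)) := by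
    intro x
    have h1 : ∀ᶠ n : ℕ in Filter.atTop, min (w x) n = v n x := by
      filter_upwards [Filter.eventually_ge_atTop (spanningSetsIndex μ x)] with n hn
      have hx := monotone_spanningSets μ hn (mem_spanningSetsIndex μ x)
      simp only [hv]
      rw [Set.indicator_of_mem hx]
    refine Filter.Tendsto.congr' h1 ?_
    have h2 := (tendsto_const_nhds (x := w x)).min ENNReal.tendsto_nat_nhds_top
    simpa using h2
  have hbound : ∀ n, ∫⁻ x, v n x ^ p ∂μ ≤ D ^ p := by
    intro n
    have hfin : ∫⁻ x, v n x ^ p ∂μ ≠ ⊤ := by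
      have h1 : ∫⁻ x, v n x ^ p ∂μ ≤ ∫⁻ x in spanningSets μ n, (n : ℝ≥0∞) ^ p ∂μ := by
        rw [← lintegral_indicator (measurableSet_spanningSets μ n)]
        refine lintegral_mono fun x => ?_
        simp only [hv, Set.indicator_apply]
        split_ifs
        · exact ENNReal.rpow_le_rpow (min_le_right _ _) hpp.nonneg
        · simp [ENNReal.zero_rpow_of_pos hpp.pos]
      refine (h1.trans_lt ?_).ne
      rw [setLIntegral_const]
      exact ENNReal.mul_lt_top
        (ENNReal.rpow_lt_top_of_nonneg hpp.nonneg (ENNReal.natCast_ne_top n))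
        (measure_spanningSets_lt_top μ n)
    refine le_rpow_of_le_mul_rpow hpp hfin ?_
    -- The extremal test function in duality: its `p'`-th power is `v n ^ p`.
    have h1 := h (fun x => v n x ^ (p - 1)) ((hvm n).pow_const _)
    have h2 : ∀ x, (v n x ^ (p - 1)) ^ p' = v n x ^ p := by
      intro x
      rw [← ENNReal.rpow_mul, hpp.sub_one_mul_conj]
    simp_rw [h2] at h1
    refine le_trans (lintegral_mono fun x => ?_) h1
    calc v n x ^ p = v n x ^ (p - 1) * v n x := by
          conv_rhs => rw [← ENNReal.rpow_one (v n x), ← ENNReal.rpow_mul, one_mul]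
          rw [← ENNReal.rpow_add_of_nonneg _ _ hpp.sub_one_pos.le zero_le_one]
          simp
      _ ≤ v n x ^ (p - 1) * w x := by
          gcongr
          exact hvw n x
  refine le_of_tendsto' (lintegral_tendsto_of_tendsto_of_monotone (fun n => (hvm n).pow_const p)
    (Filter.Eventually.of_forall fun x m n hmn => ENNReal.rpow_le_rpow (hmono x hmn) hpp.nonneg)
    (Filter.Eventually.of_forall fun x => ?_)) hbound
  exact (ENNReal.continuous_rpow_const.tendsto _).comp (hlim x)

/-- The Adams inequality for the dyadic Riesz potential with a Morrey weight. -/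
theorem exists_lintegral_rieszSum_rpow_le (d : ℕ) {p q : ℝ} (hp : 1 < p) (hpq : p < q) :
    ∃ C : ℝ≥0, ∀ (m : ℕ) (b : Spacetime d → EuclideanSpace ℝ (Fin m)),
      AEStronglyMeasurable b volume → ∀ f : Spacetime d → ℝ≥0∞, AEMeasurable f volume →
      ∫⁻ z, ‖b z‖ₑ ^ p * rieszSum f z ^ p ≤ C * morreyNorm q 1 b ^ p * ∫⁻ z, f z ^ p := by
  have hq : 1 < q := hp.trans hpq
  set p' := p.conjExponent with hp'
  set q' := q.conjExponent with hq'
  have hpp : p.HolderConjugate p' := Real.HolderConjugate.conjExponent hp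
  have hqq : q.HolderConjugate q' := Real.HolderConjugate.conjExponent hq
  have hs : 1 < p' / q' := by
    rw [one_lt_div hqq.symm.pos, hp', hq', Real.conjExponent, Real.conjExponent,
      div_lt_div_iff₀ (by linarith) (by linarith)]
    nlinarith
  obtain ⟨C₁, hC₁⟩ := exists_lintegral_mul_rieszSum_le d
  obtain ⟨C₂, hC₂⟩ := exists_fracMax_mul_le d hqq
  obtain ⟨C₃, hC₃⟩ := exists_lintegral_fracMax_rpow_le d hp
  obtain ⟨C₄, hC₄⟩ := exists_lintegral_fracMax_rpow_le d hs
  have hp0 : 0 ≤ 1 / p := one_div_nonneg.2 hpp.nonneg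
  have hp'0 : 0 ≤ 1 / p' := one_div_nonneg.2 hpp.symm.nonneg
  set B : ℝ≥0∞ := C₁ * C₂ * (C₃ : ℝ≥0∞) ^ (1 / p) * (C₄ : ℝ≥0∞) ^ (1 / p') with hB
  have hBt : B ^ p ≠ ⊤ := by
    refine ENNReal.rpow_ne_top_of_nonneg hpp.nonneg (ENNReal.mul_ne_top (ENNReal.mul_ne_top
      (ENNReal.mul_ne_top ENNReal.coe_ne_top ENNReal.coe_ne_top) ?_) ?_)
    · exact ENNReal.rpow_ne_top_of_nonneg hp0 ENNReal.coe_ne_top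
    · exact ENNReal.rpow_ne_top_of_nonneg hp'0 ENNReal.coe_ne_top
  refine ⟨(B ^ p).toNNReal, fun m b hb f hf => ?_⟩
  rw [ENNReal.coe_toNNReal hBt]
  set A := morreyNorm q 1 b with hA
  have hdual := lintegral_rpow_le_of_forall_pairing (μ := (volume : Measure (Spacetime d))) hpp
    (w := fun z => ‖b z‖ₑ * rieszSum f z) (hb.enorm.mul (measurable_rieszSum f).aemeasurable)
    (B * A * (∫⁻ z, f z ^ p) ^ (1 / p)) ?_
  · simp_rw [ENNReal.mul_rpow_of_nonneg _ _ hpp.nonneg] at hdual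
    rwa [← ENNReal.rpow_mul, one_div_mul_cancel hpp.ne_zero, ENNReal.rpow_one] at hdual
  · intro g hg
    -- `G ^ p'` is the maximal function of `g ^ q'` to the power `p' / q' > 1`, so the maximal
    -- theorem returns the integral of `g ^ p'`.
    set G : Spacetime d → ℝ≥0∞ := fun z => fracMax (d + 2) (fun x => g x ^ q') z ^ (1 / q') with hG
    have hGm : Measurable G := (measurable_fracMax _ _).pow_const _
    have hGp : ∀ z, G z ^ p' = fracMax (d + 2) (fun x => g x ^ q') z ^ (p' / q') := by
      intro z
      rw [hG, ← ENNReal.rpow_mul]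
      congr 1
      ring
    have hgp : ∀ z, (g z ^ q') ^ (p' / q') = g z ^ p' := by
      intro z
      rw [← ENNReal.rpow_mul, mul_div_cancel₀ _ hqq.symm.ne_zero]
    calc ∫⁻ z, g z * (‖b z‖ₑ * rieszSum f z)
        = ∫⁻ z, (‖b z‖ₑ * g z) * rieszSum f z := lintegral_congr fun z => by ring
      _ ≤ C₁ * ∫⁻ z, fracMax (d + 2) f z * fracMax (d + 1) (fun x => ‖b x‖ₑ * g x) z :=
          hC₁ f _ (hb.enorm.mul hg)
      _ ≤ C₁ * ∫⁻ z, C₂ * A * (fracMax (d + 2) f z * G z) := by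
          refine mul_le_mul_right (lintegral_mono fun z => ?_) _
          refine (mul_le_mul_right (hC₂ m b hb g hg z) _).trans (le_of_eq ?_)
          ring
      _ = C₁ * (C₂ * A * ∫⁻ z, fracMax (d + 2) f z * G z) := by
          rw [lintegral_const_mul (C₂ * A : ℝ≥0∞)
            (f := fun z => fracMax (d + 2) f z * G z) ((measurable_fracMax _ _).mul hGm)]
      _ ≤ C₁ * (C₂ * A * ((∫⁻ z, fracMax (d + 2) f z ^ p) ^ (1 / p) *
            (∫⁻ z, G z ^ p') ^ (1 / p'))) := by
          gcongr
          exact ENNReal.lintegral_mul_le_Lp_mul_Lq _ hpp (measurable_fracMax _ _).aemeasurable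
            hGm.aemeasurable
      _ ≤ C₁ * (C₂ * A * ((C₃ * ∫⁻ z, f z ^ p) ^ (1 / p) *
            (C₄ * ∫⁻ z, g z ^ p') ^ (1 / p'))) := by
          gcongr
          · exact hC₃ f hf
          · simp_rw [hGp]
            refine (hC₄ _ (hg.pow_const q')).trans (le_of_eq ?_)
            simp_rw [hgp]
      _ = _ := by
          rw [ENNReal.mul_rpow_of_nonneg _ _ hp0, ENNReal.mul_rpow_of_nonneg _ _ hp'0, hB]
          ring

/-! ### The parabolic potential -/

/-- With `v = r ^ 2 / s`, the ratio `max r √s / √s` is at most `1 + v`, and `(1 + v) ^ (d + 1) ≤ (d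
+ 1)! * exp (1 + v)`; the Gaussian factor cancels `exp v`. -/
lemma kernel_one_mul_max_pow_le (d : ℕ) {s r : ℝ} (hs : 0 < s) (hr : 0 ≤ r) :
    kernel d 1 s r * max r (√s) ^ (d + 1) ≤ (d + 1).factorial * Real.exp 1 := by
  have hσ : 0 < √s := Real.sqrt_pos.2 hs
  have hσ2 : √s ^ 2 = s := Real.sq_sqrt hs.le
  set σ := √s
  have h1 : s ^ (((d : ℝ) + 2 - 1) / 2) = σ ^ (d + 1) := by
    rw [← hσ2, ← Real.rpow_natCast, ← Real.rpow_natCast, ← Real.rpow_mul hσ.le]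
    congr 1
    push_cast
    ring
  have h2 : max r σ / σ ≤ 1 + r ^ 2 / s := by
    rw [div_le_iff₀ hσ, max_le_iff]
    have hv : r ^ 2 / s = (r / σ) ^ 2 := by rw [div_pow, hσ2]
    have hrσ : r = r / σ * σ := by field_simp
    have hx : 0 ≤ r / σ := by positivity
    rw [hv]
    constructor
    · conv_lhs => rw [hrσ]
      gcongr
      nlinarith [sq_nonneg (r / σ - 1)]
    · nlinarith [sq_nonneg (r / σ)]
  have hv0 : 0 ≤ r ^ 2 / s := by positivity
  have h3 := Real.pow_div_factorial_le_exp (x := 1 + r ^ 2 / s) (by positivity) (d + 1)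
  rw [div_le_iff₀ (by positivity)] at h3
  have h4 : (max r σ / σ) ^ (d + 1) ≤ Real.exp (1 + r ^ 2 / s) * (d + 1).factorial :=
    (pow_le_pow_left₀ (by positivity) h2 _).trans h3
  rw [kernel, if_pos hs, h1]
  calc 1 / σ ^ (d + 1) * Real.exp (-r ^ 2 / s) * max r σ ^ (d + 1)
      = (max r σ / σ) ^ (d + 1) * Real.exp (-r ^ 2 / s) := by
        rw [div_pow]
        ring
    _ ≤ Real.exp (1 + r ^ 2 / s) * (d + 1).factorial * Real.exp (-r ^ 2 / s) := by gcongr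
    _ = (d + 1).factorial * Real.exp 1 := by
        rw [mul_right_comm, ← Real.exp_add]
        ring_nf

/-- One term is enough: if `max (|y|, √s)` lies in `[2 ^ n, 2 ^ (n + 1))`, then `w` is in the box of
radius `2 ^ (n + 1)`, and `2 ^ (d + 1)` pays for the change of scale. -/
lemma kernel_one_le_tsum (d : ℕ) (w : Spacetime d) :
    ENNReal.ofReal (kernel d 1 w.1 ‖w.2‖) ≤
      ENNReal.ofReal ((d + 1).factorial * Real.exp 1) * 2 ^ (d + 1) *
        ∑' k : ℤ, (box (0 : Spacetime d) ((2 : ℝ) ^ k)).indicator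
          (fun _ => (((2 : ℝ≥0∞) ^ k) ^ (d + 1))⁻¹) w := by
  by_cases hs : 0 < w.1
  swap
  · simp [kernel, hs]
  have hσ : 0 < √w.1 := Real.sqrt_pos.2 hs
  set m := max ‖w.2‖ (√w.1) with hm
  have hm0 : 0 < m := lt_max_of_lt_right hσ
  set c : ℝ := (d + 1).factorial * Real.exp 1 with hc
  have hc0 : 0 ≤ c := by positivity
  obtain ⟨n, hn1, hn2⟩ := exists_mem_Ico_zpow hm0 (one_lt_two (α := ℝ))
  have hmem : w ∈ box (0 : Spacetime d) ((2 : ℝ) ^ (n + 1)) := by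
    rw [mem_box]
    simp only [Prod.fst_zero, Prod.snd_zero, sub_zero]
    refine ⟨?_, (le_max_left _ _).trans_lt hn2⟩
    rw [abs_of_pos hs, ← Real.sq_sqrt hs.le]
    have := (le_max_right ‖w.2‖ (√w.1)).trans_lt hn2
    gcongr
  have hk : kernel d 1 w.1 ‖w.2‖ ≤ c * 2 ^ (d + 1) * (((2 : ℝ) ^ (n + 1)) ^ (d + 1))⁻¹ := by
    have h1 := kernel_one_mul_max_pow_le d hs (norm_nonneg w.2)
    have h2 : kernel d 1 w.1 ‖w.2‖ ≤ c / m ^ (d + 1) := by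
      rw [le_div_iff₀ (by positivity)]
      exact h1
    refine h2.trans ?_
    have h3 : c * 2 ^ (d + 1) * (((2 : ℝ) ^ (n + 1)) ^ (d + 1))⁻¹ =
        c / ((2 : ℝ) ^ n) ^ (d + 1) := by
      rw [zpow_add_one₀ (by norm_num), mul_pow]
      field_simp
    rw [h3]
    gcongr
  calc ENNReal.ofReal (kernel d 1 w.1 ‖w.2‖)
      ≤ ENNReal.ofReal (c * 2 ^ (d + 1) * (((2 : ℝ) ^ (n + 1)) ^ (d + 1))⁻¹) :=
        ENNReal.ofReal_le_ofReal hk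
    _ = ENNReal.ofReal c * 2 ^ (d + 1) * (((2 : ℝ≥0∞) ^ (n + 1)) ^ (d + 1))⁻¹ := by
        rw [ENNReal.ofReal_mul (by positivity), ENNReal.ofReal_mul hc0,
          ENNReal.ofReal_inv_of_pos (by positivity), ENNReal.ofReal_pow (by positivity),
          ENNReal.ofReal_pow (by positivity), ofReal_two_zpow, ENNReal.ofReal_ofNat]
    _ ≤ _ := by
        refine mul_le_mul_right (le_trans ?_ (ENNReal.le_tsum (n + 1))) _
        rw [Set.indicator_of_mem hmem]

instance isAddHaarMeasure_volume :
    (volume : Measure (Spacetime d)).IsAddHaarMeasure :=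
  Measure.prod.instIsAddHaarMeasure volume volume

lemma setLIntegral_box_comp_add (f : Spacetime d → ℝ≥0∞) (z : Spacetime d) (ρ : ℝ) :
    ∫⁻ w in box 0 ρ, f (z + w) = ∫⁻ x in box z ρ, f x := by
  rw [← lintegral_indicator (measurableSet_box _ _), ← lintegral_indicator (measurableSet_box _ _),
    ← lintegral_add_left_eq_self ((box z ρ).indicator f) z]
  refine lintegral_congr fun w => ?_
  have h : z + w ∈ box z ρ ↔ w ∈ box 0 ρ := by
    simp [mem_box]
  by_cases hw : w ∈ box 0 ρ
  · rw [Set.indicator_of_mem hw, Set.indicator_of_mem (h.2 hw)]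
  · rw [Set.indicator_of_notMem hw, Set.indicator_of_notMem (fun hmem => hw (h.1 hmem))]

lemma potential_one_le_rieszSum (f : Spacetime d → ℝ≥0∞) (hf : AEMeasurable f volume)
    (z : Spacetime d) :
    potential 1 f z ≤
      ENNReal.ofReal ((d + 1).factorial * Real.exp 1) * 2 ^ (d + 1) * rieszSum f z := by
  set c := ENNReal.ofReal ((d + 1).factorial * Real.exp 1) * 2 ^ (d + 1) with hc
  have hct : c ≠ ⊤ := ENNReal.mul_ne_top ENNReal.ofReal_ne_top (ENNReal.pow_ne_top (by norm_num))
  have hfz : AEMeasurable (fun w => f (z + w)) volume :=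
    hf.comp_quasiMeasurePreserving (measurePreserving_add_left volume z).quasiMeasurePreserving
  have hm : ∀ k : ℤ, AEMeasurable (fun w => (box (0 : Spacetime d) ((2 : ℝ) ^ k)).indicator
      (fun _ => (((2 : ℝ≥0∞) ^ k) ^ (d + 1))⁻¹) w * f (z + w)) volume := fun k =>
    (measurable_const.indicator (measurableSet_box _ _)).aemeasurable.mul hfz
  calc potential 1 f z
      ≤ ∫⁻ w, c * ∑' k : ℤ, (box (0 : Spacetime d) ((2 : ℝ) ^ k)).indicator
          (fun _ => (((2 : ℝ≥0∞) ^ k) ^ (d + 1))⁻¹) w * f (z + w) := by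
        refine lintegral_mono fun w => ?_
        refine (mul_le_mul_left (kernel_one_le_tsum d w) _).trans (le_of_eq ?_)
        rw [mul_assoc, ENNReal.tsum_mul_right]
    _ = c * rieszSum f z := by
        rw [lintegral_const_mul' _ _ hct, lintegral_tsum hm, rieszSum]
        congr 1
        refine tsum_congr fun k => ?_
        rw [← setLIntegral_box_comp_add, ENNReal.div_eq_inv_mul,
          ← lintegral_const_mul'' _ hfz.restrict, ← lintegral_indicator (measurableSet_box _ _)]
        refine lintegral_congr fun w => ?_
        by_cases hw : w ∈ box (0 : Spacetime d) ((2 : ℝ) ^ k) <;> simp [hw]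

/-! ### Derivatives of smooth functions -/

lemma timeDeriv_eq_fderiv {u : Spacetime d → ℝ} (hu : ContDiff ℝ ∞ u) :
    timeDeriv u = fun z => fderiv ℝ u z (1, 0) := by
  ext z
  exact (hu.differentiable (by simp) z).lineDeriv_eq_fderiv

lemma spaceDeriv_eq_fderiv {u : Spacetime d → ℝ} (hu : ContDiff ℝ ∞ u) (i : Fin d) :
    spaceDeriv i u = fun z => fderiv ℝ u z (0, EuclideanSpace.single i 1) := by
  ext z
  exact (hu.differentiable (by simp) z).lineDeriv_eq_fderiv

lemma contDiff_fderiv_apply {u : Spacetime d → ℝ} (hu : ContDiff ℝ ∞ u) (e : Spacetime d) :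
    ContDiff ℝ ∞ fun z => fderiv ℝ u z e :=
  (hu.fderiv_right (m := ∞) (by simp)).clm_apply contDiff_const

lemma contDiff_timeDeriv {u : Spacetime d → ℝ} (hu : ContDiff ℝ ∞ u) :
    ContDiff ℝ ∞ (timeDeriv u) := by
  rw [timeDeriv_eq_fderiv hu]
  exact contDiff_fderiv_apply hu _

lemma contDiff_spaceDeriv {u : Spacetime d → ℝ} (hu : ContDiff ℝ ∞ u) (i : Fin d) :
    ContDiff ℝ ∞ (spaceDeriv i u) := by
  rw [spaceDeriv_eq_fderiv hu]
  exact contDiff_fderiv_apply hu _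

lemma hasCompactSupport_spaceDeriv {u : Spacetime d → ℝ} (hu : ContDiff ℝ ∞ u)
    (hc : HasCompactSupport u) (i : Fin d) : HasCompactSupport (spaceDeriv i u) := by
  rw [spaceDeriv_eq_fderiv hu]
  exact hc.fderiv_apply ℝ _

lemma fderiv_fderiv_apply {u : Spacetime d → ℝ} (hu : ContDiff ℝ ∞ u) (z e e' : Spacetime d) :
    fderiv ℝ (fun x => fderiv ℝ u x e) z e' = fderiv ℝ (fderiv ℝ u) z e' e := by
  have h : DifferentiableAt ℝ (fderiv ℝ u) z :=
    (hu.fderiv_right (m := ∞) (by simp)).differentiable (by simp) z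
  rw [fderiv_clm_apply h (differentiableAt_const e)]
  simp

lemma timeDeriv_spaceDeriv {u : Spacetime d → ℝ} (hu : ContDiff ℝ ∞ u) (i : Fin d) :
    timeDeriv (spaceDeriv i u) = spaceDeriv i (timeDeriv u) := by
  rw [timeDeriv_eq_fderiv (contDiff_spaceDeriv hu i), spaceDeriv_eq_fderiv (contDiff_timeDeriv hu),
    timeDeriv_eq_fderiv hu, spaceDeriv_eq_fderiv hu]
  ext z
  rw [fderiv_fderiv_apply hu, fderiv_fderiv_apply hu]
  refine (hu.contDiffAt.isSymmSndFDerivAt ?_).eq _ _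
  simp only [minSmoothness_of_isRCLikeNormedField]
  exact WithTop.coe_le_coe.2 le_top

lemma euclidean_eq_sum_single (y : EuclideanSpace ℝ (Fin d)) :
    y = ∑ j, y j • EuclideanSpace.single j (1 : ℝ) := by
  have h := (EuclideanSpace.basisFun (Fin d) ℝ).sum_repr y
  simpa using h.symm

lemma fderiv_eq_timeDeriv_add_sum {v : Spacetime d → ℝ} (hv : ContDiff ℝ ∞ v)
    (z : Spacetime d) (s : ℝ) (y : EuclideanSpace ℝ (Fin d)) :
    fderiv ℝ v z (s, y) = s * timeDeriv v z + ∑ j, y j * spaceDeriv j v z := by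
  have h : ((s, y) : Spacetime d) =
      s • ((1, 0) : Spacetime d) + ∑ j, y j • ((0, EuclideanSpace.single j 1) : Spacetime d) := by
    refine Prod.ext ?_ ?_
    · simp [Prod.fst_sum]
    · simp only [Prod.snd_add, Prod.smul_snd, smul_zero, Prod.snd_sum, zero_add]
      exact euclidean_eq_sum_single y
  rw [h, map_add, map_smul, map_sum, timeDeriv_eq_fderiv hv]
  simp only [map_smul, smul_eq_mul]
  congr 1
  refine Finset.sum_congr rfl fun j _ => ?_
  rw [spaceDeriv_eq_fderiv hv]

lemma abs_timeDeriv_le_hessTimeNorm (u : Spacetime d → ℝ) (z : Spacetime d) :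
    |timeDeriv u z| ≤ hessTimeNorm u z := by
  refine Real.abs_le_sqrt (le_add_of_nonneg_left ?_)
  positivity

lemma abs_spaceDeriv_spaceDeriv_le_hessTimeNorm (u : Spacetime d → ℝ) (z : Spacetime d)
    (i j : Fin d) : |spaceDeriv i (spaceDeriv j u) z| ≤ hessTimeNorm u z := by
  refine Real.abs_le_sqrt ?_
  have h1 : spaceDeriv i (spaceDeriv j u) z ^ 2 ≤ ∑ j, spaceDeriv i (spaceDeriv j u) z ^ 2 :=
    Finset.single_le_sum (f := fun j => spaceDeriv i (spaceDeriv j u) z ^ 2)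
      (fun _ _ => sq_nonneg _) (Finset.mem_univ j)
  have h2 : ∑ j, spaceDeriv i (spaceDeriv j u) z ^ 2 ≤
      ∑ i, ∑ j, spaceDeriv i (spaceDeriv j u) z ^ 2 :=
    Finset.single_le_sum (f := fun i => ∑ j, spaceDeriv i (spaceDeriv j u) z ^ 2)
      (fun _ _ => Finset.sum_nonneg fun _ _ => sq_nonneg _) (Finset.mem_univ i)
  linarith [sq_nonneg (timeDeriv u z)]

lemma continuous_hessTimeNorm {u : Spacetime d → ℝ} (hu : ContDiff ℝ ∞ u) :
    Continuous (hessTimeNorm u) := by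
  have h1 : ∀ i j, Continuous (spaceDeriv i (spaceDeriv j u)) := fun i j =>
    (contDiff_spaceDeriv (contDiff_spaceDeriv hu j) i).continuous
  have h2 : Continuous (timeDeriv u) := (contDiff_timeDeriv hu).continuous
  unfold hessTimeNorm
  fun_prop

/-! ### Parabolic dilations -/

/-- The parabolic dilation `(s, y) ↦ (ε² s, ε y)`. -/
def dil (ε : ℝ) (w : Spacetime d) : Spacetime d := (ε ^ 2 * w.1, ε • w.2)

lemma continuous_dil (ε : ℝ) : Continuous (dil ε : Spacetime d → Spacetime d) := by
  unfold dil
  fun_prop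

lemma continuous_dil_left (w : Spacetime d) : Continuous fun ε => dil ε w := by
  unfold dil
  fun_prop

lemma hasDerivAt_dil (w : Spacetime d) (ε : ℝ) :
    HasDerivAt (fun ε => dil ε w) (2 * ε * w.1, w.2) ε := by
  have h1 : HasDerivAt (fun ε : ℝ => ε ^ 2 * w.1) (2 * ε * w.1) ε := by
    simpa using (hasDerivAt_pow 2 ε).mul_const w.1
  have h2 : HasDerivAt (fun ε : ℝ => ε • w.2) w.2 ε := by
    simpa using (hasDerivAt_id ε).smul_const w.2
  exact h1.prodMk h2

lemma map_dil_volume {ε : ℝ} (hε : 0 < ε) :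
    Measure.map (dil ε) (volume : Measure (Spacetime d)) =
      (ENNReal.ofReal ε ^ (d + 2))⁻¹ • volume := by
  have h : (dil ε : Spacetime d → Spacetime d) =
      Prod.map (fun s : ℝ => ε ^ 2 • s) (fun y : EuclideanSpace ℝ (Fin d) => ε • y) := rfl
  rw [h, Measure.volume_eq_prod, ← Measure.map_prod_map _ _ (measurable_const_smul _)
    (measurable_const_smul _), Measure.map_addHaar_smul _ (by positivity),
    Measure.map_addHaar_smul _ hε.ne', Measure.prod_smul_left, Measure.prod_smul_right, smul_smul]
  congr 1
  rw [abs_of_pos (by positivity), abs_of_pos (by positivity),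
    ENNReal.ofReal_inv_of_pos (by positivity), ENNReal.ofReal_inv_of_pos (by positivity),
    ← ENNReal.mul_inv (Or.inr ENNReal.ofReal_ne_top) (Or.inl ENNReal.ofReal_ne_top)]
  congr 1
  rw [← ENNReal.ofReal_mul (by positivity), ← ENNReal.ofReal_pow hε.le]
  congr 1
  simp
  ring

lemma setLIntegral_box_comp_dil {f : Spacetime d → ℝ≥0∞} (hf : Measurable f) (z : Spacetime d)
    {ε : ℝ} (hε : 0 < ε) :
    ∫⁻ w in box 0 1, f (z + dil ε w) =
      (∫⁻ x in box z ε, f x) / ENNReal.ofReal ε ^ (d + 2) := by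
  have hpre : ∀ w : Spacetime d,
      dil ε w ∈ box (0 : Spacetime d) ε ↔ w ∈ box (0 : Spacetime d) 1 := by
    intro w
    simp only [mem_box, dil, Prod.fst_zero, Prod.snd_zero, sub_zero, norm_smul, abs_mul,
      Real.norm_eq_abs, abs_of_pos hε, abs_of_pos (pow_pos hε 2), one_pow]
    rw [mul_lt_iff_lt_one_right (by positivity), mul_lt_iff_lt_one_right hε]
  have hm : Measurable ((box (0 : Spacetime d) ε).indicator fun w => f (z + w)) :=
    (hf.comp (measurable_const_add z)).indicator (measurableSet_box _ _)
  rw [← setLIntegral_box_comp_add f z ε, ENNReal.div_eq_inv_mul, ← smul_eq_mul,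
    ← lintegral_indicator (measurableSet_box _ _), ← lintegral_indicator (measurableSet_box _ _),
    ← lintegral_smul_measure, ← map_dil_volume hε, lintegral_map hm (continuous_dil ε).measurable]
  refine lintegral_congr fun w => ?_
  by_cases hw : w ∈ box (0 : Spacetime d) 1
  · rw [Set.indicator_of_mem hw, Set.indicator_of_mem ((hpre w).2 hw)]
  · rw [Set.indicator_of_notMem hw, Set.indicator_of_notMem (fun hmem => hw ((hpre w).1 hmem))]

/-! ### Averages at parabolic scales -/

/-- A smooth bump function supported in the unit box. -/
def bump (d : ℕ) : ContDiffBump (0 : Spacetime d) where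
  rIn := 1 / 4
  rOut := 1 / 2
  rIn_pos := by norm_num
  rIn_lt_rOut := by norm_num

lemma tsupport_bump_subset_box : tsupport (bump d) ⊆ box (0 : Spacetime d) 1 := by
  rw [ContDiffBump.tsupport_eq]
  intro w hw
  have h : ‖w‖ ≤ 1 / 2 := by simpa [bump] using hw
  have h1 : |w.1| ≤ 1 / 2 := (norm_fst_le w).trans h
  have h2 : ‖w.2‖ ≤ 1 / 2 := (norm_snd_le w).trans h
  rw [mem_box]
  simp only [Prod.fst_zero, Prod.snd_zero, sub_zero]
  exact ⟨by linarith, by linarith⟩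

/-- The average of `v` at the parabolic scale `ε` about `z`. -/
def scaleAvg (v : Spacetime d → ℝ) (z : Spacetime d) (ε : ℝ) : ℝ :=
  ∫ w, v (z + dil ε w) * bump d w

lemma integrable_mul_bump {g : Spacetime d → ℝ} (hg : Continuous g) :
    Integrable fun w => g w * bump d w :=
  (hg.mul (bump d).continuous).integrable_of_hasCompactSupport
    (bump d).hasCompactSupport.mul_left

lemma hasDerivAt_scaleAvg {v : Spacetime d → ℝ} (hv : ContDiff ℝ ∞ v) (hc : HasCompactSupport v)
    (z : Spacetime d) (ε : ℝ) :
    HasDerivAt (scaleAvg v z)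
      (∫ w, fderiv ℝ v (z + dil ε w) (2 * ε * w.1, w.2) * bump d w) ε := by
  have hfc : Continuous (fderiv ℝ v) := hv.continuous_fderiv (by simp)
  obtain ⟨K, hK⟩ := (hc.fderiv ℝ).exists_bound_of_continuous hfc
  have hK0 : 0 ≤ K := (norm_nonneg _).trans (hK 0)
  have hdc : ∀ ε : ℝ, Continuous fun w : Spacetime d => z + dil ε w := fun ε =>
    continuous_const.add (continuous_dil ε)
  refine (hasDerivAt_integral_of_dominated_loc_of_deriv_le
    (F := fun ε w => v (z + dil ε w) * bump d w)
    (F' := fun ε w => fderiv ℝ v (z + dil ε w) (2 * ε * w.1, w.2) * bump d w)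
    -- `K` bounds `fderiv ℝ v`, and `|ε'| ≤ |ε| + 1` on the unit ball about `ε`.
    (bound := fun w => K * (2 * (|ε| + 1) * ‖w‖ + ‖w‖) * bump d w)
    (Metric.ball_mem_nhds ε one_pos) ?_ ?_ ?_ ?_ ?_ ?_).2
  · exact Filter.Eventually.of_forall fun ε' =>
      (integrable_mul_bump (hv.continuous.comp (hdc ε'))).aestronglyMeasurable
  · exact integrable_mul_bump (hv.continuous.comp (hdc ε))
  · refine (integrable_mul_bump ?_).aestronglyMeasurable
    exact (hfc.comp (hdc ε)).clm_apply (by fun_prop)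
  · refine Filter.Eventually.of_forall fun w ε' hε' => ?_
    have h1 : |ε'| ≤ |ε| + 1 := by
      have := abs_sub_abs_le_abs_sub ε' ε
      rw [Metric.mem_ball, Real.dist_eq] at hε'
      linarith
    rw [norm_mul, Real.norm_of_nonneg (bump d).nonneg]
    refine mul_le_mul_of_nonneg_right ?_ (bump d).nonneg
    refine (ContinuousLinearMap.le_of_opNorm_le _ (hK _) _).trans ?_
    gcongr
    rw [Prod.norm_def]
    refine max_le ?_ ?_
    · have h2 : |w.1| ≤ ‖w‖ := norm_fst_le w
      calc ‖2 * ε' * w.1‖ = 2 * |ε'| * |w.1| := by simp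
        _ ≤ 2 * (|ε| + 1) * ‖w‖ := by gcongr
        _ ≤ _ := le_add_of_nonneg_right (norm_nonneg _)
    · refine (norm_snd_le w).trans (le_add_of_nonneg_left ?_)
      positivity
  · exact integrable_mul_bump (by fun_prop)
  · refine Filter.Eventually.of_forall fun w ε' _ => ?_
    have h1 : HasDerivAt (fun ε => z + dil ε w) (2 * ε' * w.1, w.2) ε' :=
      (hasDerivAt_dil w ε').const_add z
    exact (((hv.differentiable (by simp) _).hasFDerivAt).comp_hasDerivAt ε' h1).mul_const _

/-- The derivative of `τ (z + dil ε w)` in `w` along the `i`-th spatial axis is `ε * D_i τ`, so the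
factor `ε` is absorbed by the integration by parts. The weight `w.1` is constant along that axis. -/
lemma integral_spaceDeriv_comp_dil_mul_bump {τ : Spacetime d → ℝ} (hτ : ContDiff ℝ ∞ τ)
    (z : Spacetime d) (ε : ℝ) (i : Fin d) :
    ∫ w, (2 * ε * w.1 * spaceDeriv i τ (z + dil ε w)) * bump d w =
      -∫ w, τ (z + dil ε w) * (2 * w.1 * spaceDeriv i (bump d) w) := by
  set e : Spacetime d := (0, EuclideanSpace.single i 1) with he
  set φ : Spacetime d → ℝ := ⇑(bump d) with hφ
  have hφs : ContDiff ℝ ∞ φ := (bump d).contDiff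
  have hdc : Continuous fun w : Spacetime d => z + dil ε w :=
    continuous_const.add (continuous_dil ε)
  have hf' : ∀ w, HasLineDerivAt ℝ (fun w => τ (z + dil ε w))
      (ε * spaceDeriv i τ (z + dil ε w)) w e := by
    intro w
    have h1 : HasDerivAt (fun t : ℝ => z + dil ε (w + t • e)) (ε • e) 0 := by
      have h2 : ∀ t : ℝ, z + dil ε (w + t • e) = (z + dil ε w) + t • (ε • e) := by
        intro t
        refine Prod.ext ?_ ?_
        · simp [dil, he]
        · simp only [dil, he, Prod.snd_add, Prod.smul_snd, smul_add, add_assoc, smul_smul, mul_comm]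
      simp_rw [h2]
      simpa using ((hasDerivAt_id (0 : ℝ)).smul_const (ε • e)).const_add (z + dil ε w)
    have h3 : HasFDerivAt τ (fderiv ℝ τ (z + dil ε w)) (z + dil ε (w + (0 : ℝ) • e)) := by
      simpa using (hτ.differentiable (by simp) (z + dil ε w)).hasFDerivAt
    have h4 := h3.comp_hasDerivAt (0 : ℝ) h1
    rw [map_smul, smul_eq_mul] at h4
    rw [spaceDeriv_eq_fderiv hτ]
    exact h4
  have hg' : ∀ w : Spacetime d, HasLineDerivAt ℝ (fun w => 2 * w.1 * φ w)
      (2 * w.1 * spaceDeriv i φ w) w e := by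
    intro w
    have h1 : HasLineDerivAt ℝ φ (spaceDeriv i φ w) w e :=
      ((hφs.differentiable (by simp) w).lineDifferentiableAt).hasLineDerivAt
    have h2 := HasDerivAt.const_mul (2 * w.1) h1
    have h3 : (fun t : ℝ => 2 * (w + t • e).1 * φ (w + t • e)) =
        fun t => 2 * w.1 * φ (w + t • e) := by
      ext t
      simp [he]
    unfold HasLineDerivAt
    simp only [h3]
    exact h2
  have hs : Continuous (spaceDeriv i τ) := (contDiff_spaceDeriv hτ i).continuous
  have hsφ : Continuous (spaceDeriv i φ) := (contDiff_spaceDeriv hφs i).continuous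
  have hsc : HasCompactSupport (spaceDeriv i φ) :=
    hasCompactSupport_spaceDeriv hφs (bump d).hasCompactSupport i
  have hi1 : Integrable fun w => (ε * spaceDeriv i τ (z + dil ε w)) * (2 * w.1 * φ w) := by
    refine (integrable_mul_bump (g := fun w => (ε * spaceDeriv i τ (z + dil ε w)) * (2 * w.1))
      ?_).congr (Filter.Eventually.of_forall fun w => by simp only [hφ]; ring)
    exact (continuous_const.mul (hs.comp hdc)).mul (by fun_prop)
  have hi2 : Integrable fun w => τ (z + dil ε w) * (2 * w.1 * spaceDeriv i φ w) := by
    refine Continuous.integrable_of_hasCompactSupport ?_ ?_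
    · exact (hτ.continuous.comp hdc).mul ((by fun_prop : Continuous fun w : Spacetime d =>
        2 * w.1).mul hsφ)
    · exact (hsc.mul_left (f := fun w : Spacetime d => 2 * w.1)).mul_left
  have hi3 : Integrable fun w => τ (z + dil ε w) * (2 * w.1 * φ w) := by
    refine (integrable_mul_bump (g := fun w => τ (z + dil ε w) * (2 * w.1))
      ?_).congr (Filter.Eventually.of_forall fun w => by simp only [hφ]; ring)
    exact (hτ.continuous.comp hdc).mul (by fun_prop)
  have key := integral_bilinear_hasLineDerivAt_right_eq_neg_left_of_integrable
    (μ := (volume : Measure (Spacetime d))) (B := ContinuousLinearMap.mul ℝ ℝ) hi1 hi2 hi3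
    (fun w _ => hf' w) (fun w _ => hg' w)
  simp only [ContinuousLinearMap.mul_apply'] at key
  rw [key, neg_neg]
  exact integral_congr_ae (Filter.Eventually.of_forall fun w => by simp only; ring)

/-- The derivative in the scale of the averages of `D_i u`, with one integration by parts. -/
lemma hasDerivAt_scaleAvg_spaceDeriv {u : Spacetime d → ℝ} (hu : ContDiff ℝ ∞ u)
    (hc : HasCompactSupport u) (i : Fin d) (z : Spacetime d) (ε : ℝ) :
    HasDerivAt (scaleAvg (spaceDeriv i u) z)
      (∫ w, ((∑ j, w.2 j * spaceDeriv j (spaceDeriv i u) (z + dil ε w)) * bump d w -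
        timeDeriv u (z + dil ε w) * (2 * w.1 * spaceDeriv i (bump d) w))) ε := by
  have hv := contDiff_spaceDeriv hu i
  have hτ := contDiff_timeDeriv hu
  have hφs : ContDiff ℝ ∞ (bump d : Spacetime d → ℝ) := (bump d).contDiff
  have hdc : Continuous fun w : Spacetime d => z + dil ε w :=
    continuous_const.add (continuous_dil ε)
  have hi1 : Integrable fun w : Spacetime d =>
      (∑ j, w.2 j * spaceDeriv j (spaceDeriv i u) (z + dil ε w)) * bump d w := by
    refine integrable_mul_bump (continuous_finsetSum _ fun j _ => Continuous.mul (by fun_prop) ?_)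
    exact (contDiff_spaceDeriv hv j).continuous.comp hdc
  have hi2 : Integrable fun w => timeDeriv u (z + dil ε w) *
      (2 * w.1 * spaceDeriv i (bump d) w) := by
    refine Continuous.integrable_of_hasCompactSupport ?_ ?_
    · exact (hτ.continuous.comp hdc).mul ((by fun_prop : Continuous fun w : Spacetime d =>
        2 * w.1).mul (contDiff_spaceDeriv hφs i).continuous)
    · exact ((hasCompactSupport_spaceDeriv hφs (bump d).hasCompactSupport i).mul_left
        (f := fun w : Spacetime d => 2 * w.1)).mul_left
  have hi3 : Integrable fun w : Spacetime d =>
      (2 * ε * w.1 * spaceDeriv i (timeDeriv u) (z + dil ε w)) * bump d w := by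
    refine integrable_mul_bump (Continuous.mul (by fun_prop) ?_)
    exact (contDiff_spaceDeriv hτ i).continuous.comp hdc
  convert hasDerivAt_scaleAvg hv (hasCompactSupport_spaceDeriv hu hc i) z ε using 1
  rw [integral_sub hi1 hi2, sub_eq_add_neg, ← integral_spaceDeriv_comp_dil_mul_bump hτ,
    ← integral_add hi1 hi3]
  refine integral_congr_ae (Filter.Eventually.of_forall fun w => ?_)
  simp only
  rw [fderiv_eq_timeDeriv_add_sum hv, timeDeriv_spaceDeriv hu]
  ring

/-- Dominated convergence. The bump is not normalised, so its integral remains in the limit. -/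
lemma tendsto_scaleAvg_zero {v : Spacetime d → ℝ} (hv : Continuous v) (hc : HasCompactSupport v)
    (z : Spacetime d) :
    Filter.Tendsto (fun n : ℕ => scaleAvg v z ((2 : ℝ) ^ (-(n : ℤ)))) Filter.atTop
      (nhds (v z * ∫ w, bump d w)) := by
  obtain ⟨K, hK⟩ := hc.exists_bound_of_continuous hv
  rw [← integral_const_mul]
  refine tendsto_integral_of_dominated_convergence (fun w => K * bump d w) (fun n => ?_)
    (integrable_mul_bump continuous_const) (fun n => Filter.Eventually.of_forall fun w => ?_)
    (Filter.Eventually.of_forall fun w => ?_)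
  · exact (integrable_mul_bump (hv.comp
      (continuous_const.add (continuous_dil _)))).aestronglyMeasurable
  · rw [norm_mul, Real.norm_of_nonneg (bump d).nonneg]
    exact mul_le_mul_of_nonneg_right (hK _) (bump d).nonneg
  · have h1 : Filter.Tendsto (fun n : ℕ => (2 : ℝ) ^ (-(n : ℤ))) Filter.atTop (nhds 0) := by
      have := tendsto_pow_atTop_nhds_zero_of_lt_one (r := (1 / 2 : ℝ)) (by norm_num) (by norm_num)
      refine this.congr fun n => ?_
      rw [zpow_neg, zpow_natCast, one_div, inv_pow]
    have h2 : Continuous fun ε => v (z + dil ε w) * bump d w :=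
      (hv.comp (continuous_const.add (continuous_dil_left w))).mul continuous_const
    have h3 := (h2.tendsto 0).comp h1
    have h4 : dil 0 w = 0 := by simp [dil]
    simpa [h4, Function.comp_def] using h3

/-- For `w.1 ≠ 0`, that is for almost every `w`, the time coordinate of `z + dil ε w` eventually
leaves the compact support of `v`. -/
lemma tendsto_scaleAvg_atTop {v : Spacetime d → ℝ} (hv : Continuous v) (hc : HasCompactSupport v)
    (z : Spacetime d) :
    Filter.Tendsto (fun n : ℕ => scaleAvg v z ((2 : ℝ) ^ (n : ℤ))) Filter.atTop (nhds 0) := by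
  obtain ⟨K, hK⟩ := hc.exists_bound_of_continuous hv
  have h0 : ∫ w : Spacetime d, (0 : ℝ) = 0 := by simp
  rw [← h0]
  have hae : ∀ᵐ w : Spacetime d, w.1 ≠ 0 := by
    have h1 : ∀ᵐ s : ℝ, s ≠ 0 := by simp [ae_iff]
    exact Measure.quasiMeasurePreserving_fst.ae h1
  refine tendsto_integral_of_dominated_convergence (fun w => K * bump d w) (fun n => ?_)
    (integrable_mul_bump continuous_const) (fun n => Filter.Eventually.of_forall fun w => ?_) ?_
  · exact (integrable_mul_bump (hv.comp
      (continuous_const.add (continuous_dil _)))).aestronglyMeasurable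
  · rw [norm_mul, Real.norm_of_nonneg (bump d).nonneg]
    exact mul_le_mul_of_nonneg_right (hK _) (bump d).nonneg
  · filter_upwards [hae] with w hw
    obtain ⟨R, hR⟩ := hc.isCompact.isBounded.exists_norm_le
    refine tendsto_const_nhds.congr' ?_
    have h1 : Filter.Tendsto (fun n : ℕ => ((2 : ℝ) ^ (n : ℤ)) ^ 2 * |w.1|) Filter.atTop
        Filter.atTop := by
      refine Filter.Tendsto.atTop_mul_const (abs_pos.2 hw) ?_
      have := tendsto_pow_atTop_atTop_of_one_lt (r := (4 : ℝ)) (by norm_num)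
      refine this.congr fun n => ?_
      rw [zpow_natCast, ← pow_mul, mul_comm, pow_mul]
      norm_num
    filter_upwards [h1.eventually_gt_atTop (R + |z.1|)] with n hn
    have h2 : v (z + dil ((2 : ℝ) ^ (n : ℤ)) w) = 0 := by
      refine image_eq_zero_of_notMem_tsupport fun hmem => ?_
      have h3 := (norm_fst_le _).trans (hR _ hmem)
      have h4 : |((2 : ℝ) ^ (n : ℤ)) ^ 2 * w.1| ≤
          |z.1 + ((2 : ℝ) ^ (n : ℤ)) ^ 2 * w.1| + |z.1| := by
        have := abs_sub (z.1 + ((2 : ℝ) ^ (n : ℤ)) ^ 2 * w.1) z.1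
        rwa [add_sub_cancel_left] at this
      rw [abs_mul, abs_of_pos (by positivity)] at h4
      simp only [dil, Prod.fst_add, Real.norm_eq_abs] at h3
      linarith
    rw [h2, zero_mul]

/-! ### The pointwise gradient estimate -/

/-- On the unit box the coordinates of `w` and the bump are at most `1`: the second derivatives
contribute `d`, the time derivative `2 L` with `L` a bound for the derivative of the bump. Undoing
the dilation gives the power of `ε`. -/
lemma exists_enorm_scaleAvg_deriv_le (d : ℕ) :
    ∃ C : ℝ≥0, ∀ u : Spacetime d → ℝ, ContDiff ℝ ∞ u → ∀ (i : Fin d) (z : Spacetime d) (ε : ℝ),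
      0 < ε →
      ‖∫ w, ((∑ j, w.2 j * spaceDeriv j (spaceDeriv i u) (z + dil ε w)) * bump d w -
        timeDeriv u (z + dil ε w) * (2 * w.1 * spaceDeriv i (bump d) w))‖ₑ ≤
      C * ((∫⁻ x in box z ε, ‖hessTimeNorm u x‖ₑ) / ENNReal.ofReal ε ^ (d + 2)) := by
  have hφs : ContDiff ℝ ∞ (bump d : Spacetime d → ℝ) := (bump d).contDiff
  obtain ⟨L, hL⟩ := ((bump d).hasCompactSupport.fderiv ℝ).exists_bound_of_continuous
    (hφs.continuous_fderiv (by simp))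
  have hL0 : 0 ≤ L := (norm_nonneg _).trans (hL 0)
  have hder : ∀ i w, |spaceDeriv i (bump d) w| ≤ L := by
    intro i w
    rw [spaceDeriv_eq_fderiv hφs]
    refine (ContinuousLinearMap.le_of_opNorm_le _ (hL w) _).trans ?_
    simp [Prod.norm_def]
  refine ⟨(d + 2 * L).toNNReal, fun u hu i z ε hε => ?_⟩
  have hFm : Measurable fun x => ‖hessTimeNorm u x‖ₑ :=
    (continuous_hessTimeNorm hu).measurable.enorm
  rw [← setLIntegral_box_comp_dil hFm z hε]
  refine (enorm_integral_le_lintegral_enorm _).trans ?_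
  rw [← lintegral_const_mul' _ _ ENNReal.coe_ne_top, ← lintegral_indicator (measurableSet_box _ _)]
  refine lintegral_mono fun w => ?_
  by_cases hw : w ∈ box (0 : Spacetime d) 1
  · rw [Set.indicator_of_mem hw]
    simp only
    set x := z + dil ε w
    set F := hessTimeNorm u x with hF
    have hF0 : 0 ≤ F := Real.sqrt_nonneg _
    rw [mem_box] at hw
    simp only [Prod.fst_zero, Prod.snd_zero, sub_zero, one_pow] at hw
    have h1 : |∑ j, w.2 j * spaceDeriv j (spaceDeriv i u) x| ≤ d * F := by
      refine (Finset.abs_sum_le_sum_abs _ _).trans ?_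
      refine (Finset.sum_le_card_nsmul _ _ F fun j _ => ?_).trans (by simp)
      rw [abs_mul]
      have h2 : |w.2 j| ≤ 1 := (PiLp.norm_apply_le w.2 j).trans hw.2.le
      exact (mul_le_of_le_one_left (abs_nonneg _) h2).trans
        (abs_spaceDeriv_spaceDeriv_le_hessTimeNorm u x j i)
    have h3 : |(∑ j, w.2 j * spaceDeriv j (spaceDeriv i u) x) * bump d w| ≤ d * F := by
      rw [abs_mul, abs_of_nonneg (bump d).nonneg]
      exact (mul_le_of_le_one_right (abs_nonneg _) (bump d).le_one).trans h1
    have h4 : |timeDeriv u x * (2 * w.1 * spaceDeriv i (bump d) w)| ≤ F * (2 * 1 * L) := by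
      rw [abs_mul, abs_mul, abs_mul, abs_two]
      gcongr
      · exact abs_timeDeriv_le_hessTimeNorm u x
      · exact hw.1.le
      · exact hder i w
    have h5 : ‖(∑ j, w.2 j * spaceDeriv j (spaceDeriv i u) x) * bump d w -
        timeDeriv u x * (2 * w.1 * spaceDeriv i (bump d) w)‖ ≤ (d + 2 * L) * F := by
      refine (abs_sub _ _).trans ?_
      linarith
    rw [Real.enorm_of_nonneg hF0, ← ofReal_norm]
    change _ ≤ ENNReal.ofReal (d + 2 * L) * ENNReal.ofReal F
    rw [← ENNReal.ofReal_mul (by positivity)]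
    exact ENNReal.ofReal_le_ofReal h5
  · have h1 : w ∉ tsupport (bump d) := fun h => hw (tsupport_bump_subset_box h)
    have h2 : bump d w = 0 := image_eq_zero_of_notMem_tsupport h1
    have h3 : spaceDeriv i (bump d) w = 0 := by
      rw [spaceDeriv_eq_fderiv hφs]
      simp [fderiv_of_notMem_tsupport (𝕜 := ℝ) h1]
    simp [h2, h3]

/-- Mean value inequality on an interval of length `2 ^ k`: this length turns the exponent `d + 2`
into `d + 1`, and passing from `2 ^ k` to `2 ^ (k + 1)` in the denominator costs `2 ^ (d + 1)`. -/
lemma exists_enorm_scaleAvg_sub_le (d : ℕ) :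
    ∃ C : ℝ≥0, ∀ u : Spacetime d → ℝ, ContDiff ℝ ∞ u → HasCompactSupport u →
      ∀ (i : Fin d) (z : Spacetime d) (k : ℤ),
      ‖scaleAvg (spaceDeriv i u) z ((2 : ℝ) ^ (k + 1)) -
        scaleAvg (spaceDeriv i u) z ((2 : ℝ) ^ k)‖ₑ ≤
      C * ((∫⁻ x in box z ((2 : ℝ) ^ (k + 1)), ‖hessTimeNorm u x‖ₑ) /
        ((2 : ℝ≥0∞) ^ (k + 1)) ^ (d + 1)) := by
  obtain ⟨C, hC⟩ := exists_enorm_scaleAvg_deriv_le d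
  refine ⟨C * 2 ^ (d + 1), fun u hu hc i z k => ?_⟩
  set I := ∫⁻ x in box z ((2 : ℝ) ^ (k + 1)), ‖hessTimeNorm u x‖ₑ with hI
  set r : ℝ≥0∞ := (2 : ℝ≥0∞) ^ k with hr
  have hr0 : r ≠ 0 := two_zpow_ne_zero k
  have hrt : r ≠ ⊤ := two_zpow_ne_top k
  have hk : (2 : ℝ) ^ (k + 1) = 2 ^ k + 2 ^ k := by
    rw [zpow_add_one₀ (by norm_num)]
    ring
  have hkpos : (0 : ℝ) < 2 ^ k := by positivity
  have hder : ∀ ε ∈ Set.Icc ((2 : ℝ) ^ k) (2 ^ (k + 1)),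
      ‖∫ w, ((∑ j, w.2 j * spaceDeriv j (spaceDeriv i u) (z + dil ε w)) * bump d w -
        timeDeriv u (z + dil ε w) * (2 * w.1 * spaceDeriv i (bump d) w))‖ₑ ≤
      C * (I / r ^ (d + 2)) := by
    intro ε hε
    have hε0 : 0 < ε := hkpos.trans_le hε.1
    refine (hC u hu i z ε hε0).trans ?_
    refine mul_le_mul_right (ENNReal.div_le_div (lintegral_mono_set
      (box_mono z hε0.le hε.2)) ?_) _
    rw [hr, ← ofReal_two_zpow]
    gcongr
    exact hε.1
  have hpow : (C * (I / r ^ (d + 2))) * r =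
      ((C * 2 ^ (d + 1) : ℝ≥0) : ℝ≥0∞) * (I / ((2 : ℝ≥0∞) ^ (k + 1)) ^ (d + 1)) := by
    have h2 : (2 : ℝ≥0∞) ^ (k + 1) = 2 * r := by
      rw [ENNReal.zpow_add (by norm_num) (by norm_num), zpow_one, mul_comm]
    have e1 : (2 : ℝ≥0∞) ^ (d + 1) * (2 ^ (d + 1))⁻¹ = 1 :=
      ENNReal.mul_inv_cancel (pow_ne_zero _ (by norm_num)) (ENNReal.pow_ne_top (by norm_num))
    have e2 : r⁻¹ * r = 1 := ENNReal.inv_mul_cancel hr0 hrt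
    rw [h2, mul_pow, pow_succ r (d + 1), ENNReal.div_eq_inv_mul, ENNReal.div_eq_inv_mul,
      ENNReal.mul_inv (Or.inr hrt) (Or.inr hr0),
      ENNReal.mul_inv (Or.inl (pow_ne_zero _ (by norm_num)))
        (Or.inl (ENNReal.pow_ne_top (by norm_num)))]
    push_cast
    calc _ = C * ((r ^ (d + 1))⁻¹ * I) * (r⁻¹ * r) := by ring
      _ = C * ((r ^ (d + 1))⁻¹ * I) * ((2 : ℝ≥0∞) ^ (d + 1) * (2 ^ (d + 1))⁻¹) := by rw [e1, e2]
      _ = _ := by ring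
  rw [← hpow]
  set B : ℝ≥0∞ := C * (I / r ^ (d + 2)) with hB
  rcases eq_or_ne B ⊤ with hBt | hBt
  · rw [hBt, ENNReal.top_mul hr0]
    exact le_top
  have hmv := Convex.norm_image_sub_le_of_norm_hasDerivWithin_le (C := B.toReal)
    (fun ε _ => (hasDerivAt_scaleAvg_spaceDeriv hu hc i z ε).hasDerivWithinAt)
    (fun ε hε => by
      rw [← toReal_enorm]
      exact ENNReal.toReal_mono hBt (hder ε hε))
    (convex_Icc ((2 : ℝ) ^ k) (2 ^ (k + 1)))
    (Set.left_mem_Icc.2 (by linarith)) (Set.right_mem_Icc.2 (by linarith))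
  rw [← ofReal_norm]
  refine (ENNReal.ofReal_le_ofReal hmv).trans (le_of_eq ?_)
  rw [ENNReal.ofReal_mul ENNReal.toReal_nonneg, ENNReal.ofReal_toReal hBt, hk, add_sub_cancel_left,
    Real.norm_of_nonneg hkpos.le, ofReal_two_zpow]

/-- Each `D_i u` is controlled pointwise by the Riesz potential of `|(D²u, ∂_t u)|`. -/
lemma exists_enorm_spaceDeriv_le (d : ℕ) :
    ∃ C : ℝ≥0, ∀ u : Spacetime d → ℝ, ContDiff ℝ ∞ u → HasCompactSupport u →
      ∀ (i : Fin d) (z : Spacetime d),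
      ‖spaceDeriv i u z‖ₑ ≤ C * rieszSum (fun x => ‖hessTimeNorm u x‖ₑ) z := by
  obtain ⟨C, hC⟩ := exists_enorm_scaleAvg_sub_le d
  set J : ℝ := ∫ w, bump d w with hJ
  have hJ0 : 0 < J := (bump d).integral_pos
  refine ⟨J.toNNReal⁻¹ * C, fun u hu hc i z => ?_⟩
  set v := spaceDeriv i u with hv
  set S := rieszSum (fun x => ‖hessTimeNorm u x‖ₑ) z with hS
  have hvc : Continuous v := (contDiff_spaceDeriv hu i).continuous
  have hvs : HasCompactSupport v := hasCompactSupport_spaceDeriv hu hc i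
  -- Telescoping in `2 n` dyadic steps from `2 ^ (-n)` to `2 ^ n`; distinct steps use distinct
  -- scales of `rieszSum`, so the bound is uniform in `n`.
  have hstep : ∀ n : ℕ, edist (scaleAvg v z ((2 : ℝ) ^ (-(n : ℤ))))
      (scaleAvg v z ((2 : ℝ) ^ (n : ℤ))) ≤ C * S := by
    intro n
    have h1 := edist_le_range_sum_edist (fun m : ℕ => scaleAvg v z ((2 : ℝ) ^ (-(n : ℤ) + m)))
      (2 * n)
    have e1 : -(n : ℤ) + ((0 : ℕ) : ℤ) = -n := by simp
    have e2 : -(n : ℤ) + ((2 * n : ℕ) : ℤ) = n := by push_cast; ring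
    simp only [e1, e2] at h1
    refine h1.trans ?_
    calc ∑ m ∈ Finset.range (2 * n), edist (scaleAvg v z ((2 : ℝ) ^ (-(n : ℤ) + m)))
          (scaleAvg v z ((2 : ℝ) ^ (-(n : ℤ) + ((m + 1 : ℕ) : ℤ))))
        ≤ ∑ m ∈ Finset.range (2 * n), C *
          ((∫⁻ x in box z ((2 : ℝ) ^ (-(n : ℤ) + m + 1)), ‖hessTimeNorm u x‖ₑ) /
            ((2 : ℝ≥0∞) ^ (-(n : ℤ) + m + 1)) ^ (d + 1)) := by
          refine Finset.sum_le_sum fun m _ => ?_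
          rw [edist_comm, edist_eq_enorm_sub]
          push_cast
          rw [← add_assoc]
          exact hC u hu hc i z _
      _ ≤ C * ∑' m : ℕ,
          ((∫⁻ x in box z ((2 : ℝ) ^ (-(n : ℤ) + m + 1)), ‖hessTimeNorm u x‖ₑ) /
            ((2 : ℝ≥0∞) ^ (-(n : ℤ) + m + 1)) ^ (d + 1)) := by
          rw [← Finset.mul_sum]
          exact mul_le_mul_right (ENNReal.sum_le_tsum _) _
      _ ≤ C * S := by
          refine mul_le_mul_right ?_ _
          exact ENNReal.tsum_comp_le_tsum_of_injective
            (f := fun m : ℕ => -(n : ℤ) + m + 1) (fun a b h => by simpa using h)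
            (fun k : ℤ => (∫⁻ x in box z ((2 : ℝ) ^ k), ‖hessTimeNorm u x‖ₑ) /
              ((2 : ℝ≥0∞) ^ k) ^ (d + 1))
  have hlim := le_of_tendsto'
    ((tendsto_scaleAvg_zero hvc hvs z).edist (tendsto_scaleAvg_atTop hvc hvs z)) hstep
  rw [edist_zero_right, enorm_mul, ← hJ, Real.enorm_of_nonneg hJ0.le, ENNReal.ofReal] at hlim
  have hJn : J.toNNReal ≠ 0 := by simpa using hJ0
  have hJe : (J.toNNReal : ℝ≥0∞) ≠ 0 := by exact_mod_cast hJn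
  rw [ENNReal.coe_mul, ENNReal.coe_inv hJn, mul_assoc]
  calc ‖v z‖ₑ = (J.toNNReal : ℝ≥0∞)⁻¹ * (‖v z‖ₑ * J.toNNReal) := by
        rw [mul_left_comm, ENNReal.inv_mul_cancel hJe ENNReal.coe_ne_top, mul_one]
    _ ≤ _ := mul_le_mul_right hlim _

lemma exists_enorm_spaceGrad_le (d : ℕ) :
    ∃ C : ℝ≥0, ∀ u : Spacetime d → ℝ, ContDiff ℝ ∞ u → HasCompactSupport u →
      ∀ z : Spacetime d,
      ‖spaceGrad u z‖ₑ ≤ C * rieszSum (fun x => ‖hessTimeNorm u x‖ₑ) z := by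
  obtain ⟨C, hC⟩ := exists_enorm_spaceDeriv_le d
  refine ⟨d * C, fun u hu hc z => ?_⟩
  have h1 : ‖spaceGrad u z‖ₑ ≤ ∑ i, ‖spaceDeriv i u z‖ₑ := by
    rw [euclidean_eq_sum_single (spaceGrad u z)]
    refine (enorm_sum_le _ _).trans (le_of_eq ?_)
    refine Finset.sum_congr rfl fun i _ => ?_
    rw [enorm_smul]
    simp [spaceGrad, enorm]
  refine h1.trans ((Finset.sum_le_card_nsmul _ _ _ fun i _ => hC u hu hc i z).trans ?_)
  simp [mul_assoc]

end ParabolicMorrey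

end

/-! ### The two Morrey-weighted inequalities -/

open ParabolicMorrey in
theorem theorem4p1 (d : ℕ) (hd : 1 ≤ d) (p q : ℝ) (hp : 1 < p) (hpq : p < q)
    (hq : q ≤ (d : ℝ) + 2) :
    ∃ N : ℝ≥0, ∀ (m : ℕ) (b : ParabolicMorrey.Spacetime d → EuclideanSpace ℝ (Fin m)),
      ParabolicMorrey.MemMorrey q 1 b →
      (∀ f : ParabolicMorrey.Spacetime d → ℝ≥0∞, AEMeasurable f volume →
        ∫⁻ z, ‖b z‖ₑ ^ p * ParabolicMorrey.potential 1 f z ^ p ≤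
          N * ParabolicMorrey.morreyNorm q 1 b ^ p *
            eLpNorm f (ENNReal.ofReal p) volume ^ p) ∧
      (∀ u : ParabolicMorrey.Spacetime d → ℝ, ContDiff ℝ ∞ u → HasCompactSupport u →
        ∫⁻ z, ‖b z‖ₑ ^ p * ‖ParabolicMorrey.spaceGrad u z‖ₑ ^ p ≤
          N * ParabolicMorrey.morreyNorm q 1 b ^ p *
            eLpNorm (ParabolicMorrey.hessTimeNorm u) (ENNReal.ofReal p) volume ^ p) := by
  have hp0 : 0 < p := one_pos.trans hp
  obtain ⟨C, hC⟩ := exists_lintegral_rieszSum_rpow_le d hp hpq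
  obtain ⟨G, hG⟩ := exists_enorm_spaceGrad_le d
  set P : ℝ≥0∞ := ENNReal.ofReal ((d + 1).factorial * Real.exp 1) * 2 ^ (d + 1) with hP
  have hPt : P ≠ ⊤ := ENNReal.mul_ne_top ENNReal.ofReal_ne_top (ENNReal.pow_ne_top (by norm_num))
  set K : ℝ≥0∞ := max P G with hK
  have hKt : K ^ p * C ≠ ⊤ := by
    refine ENNReal.mul_ne_top (ENNReal.rpow_ne_top_of_nonneg hp0.le ?_) ENNReal.coe_ne_top
    exact max_ne_top hPt ENNReal.coe_ne_top
  have hLp : ∀ {E : Type} [TopologicalSpace E] [ContinuousENorm E]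
      (g : ParabolicMorrey.Spacetime d → E),
      eLpNorm g (ENNReal.ofReal p) volume ^ p = ∫⁻ z, ‖g z‖ₑ ^ p := by
    intro E _ _ g
    rw [eLpNorm_eq_lintegral_rpow_enorm_toReal (by simpa using hp0) ENNReal.ofReal_ne_top,
      ENNReal.toReal_ofReal hp0.le, ← ENNReal.rpow_mul, one_div_mul_cancel hp0.ne',
      ENNReal.rpow_one]
  refine ⟨(K ^ p * C).toNNReal, fun m b hb => ?_⟩
  rw [ENNReal.coe_toNNReal hKt]
  -- Both parts follow from the Adams estimate once the left-hand function is dominated pointwise by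
  -- `K * rieszSum f`; `K` is a maximum so that one constant serves both.
  have key : ∀ f g : ParabolicMorrey.Spacetime d → ℝ≥0∞, AEMeasurable f volume →
      (∀ z, g z ≤ K * rieszSum f z) →
      ∫⁻ z, ‖b z‖ₑ ^ p * g z ^ p ≤ K ^ p * C * morreyNorm q 1 b ^ p * ∫⁻ z, f z ^ p := by
    intro f g hf hg
    calc ∫⁻ z, ‖b z‖ₑ ^ p * g z ^ p
        ≤ ∫⁻ z, K ^ p * (‖b z‖ₑ ^ p * rieszSum f z ^ p) := by
          refine lintegral_mono fun z => ?_
          rw [mul_left_comm, ← ENNReal.mul_rpow_of_nonneg K _ hp0.le]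
          gcongr
          exact hg z
      _ = K ^ p * ∫⁻ z, ‖b z‖ₑ ^ p * rieszSum f z ^ p :=
          lintegral_const_mul' _ _
            (ENNReal.rpow_ne_top_of_nonneg hp0.le (max_ne_top hPt ENNReal.coe_ne_top))
      _ ≤ K ^ p * (C * morreyNorm q 1 b ^ p * ∫⁻ z, f z ^ p) :=
          mul_le_mul_right (hC m b hb.1 f hf) _
      _ = _ := by ring
  refine ⟨fun f hf => ?_, fun u hu hc => ?_⟩
  · rw [hLp]
    refine key f _ hf fun z => (potential_one_le_rieszSum f hf z).trans ?_
    gcongr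
    exact le_max_left _ _
  · rw [hLp]
    refine key _ _ (continuous_hessTimeNorm hu).measurable.enorm.aemeasurable fun z =>
      (hG u hu hc z).trans ?_
    gcongr
    exact le_max_right _ _
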